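/- Fix a notion of small set and a larger notion of large set (sets of a Grothendieck universe, resp. of a larger one). Let $(\mathcal V,\otimes,\mathbf 1)$ be a (not necessarily symmetric) monoidal category with a large set of objects and small hom-sets, which has all small limits and colimits, is accessible, and is closed: every functor $M\otimes-$ has a right adjoint $Z\mapsto Z^M$. Let $\mathcal C$ be an accessible category with a large set of objects and small hom-sets, enriched over $\mathcal V$, with hom objects $[X,Y]$ and composition written $[X,Y]\otimes[Y,Z]\to[X,Z]$. (With the convention $[Y,Z]\otimes[X,Y]\to[X,Z]$ one replaces $\otimes$ by the reverse tensor product, so that $Z\mapsto Z^M$ is right adjoint to $-\otimes M$.) Assume that $\mathcal C$ is accessibly tensored over $\mathcal V$: for all $M\in\mathcal V$, $X\in\mathcal C$ the functor $Y\mapsto[X,Y]^M$ is $\mathcal V$-representable, by an object $M\otimes X$ of $\mathcal C$, and for every $M$ the functor $X\mapsto M\otimes X$, $\mathcal C\to\mathcal C$, is accessible. For a monoid $M$ in $\mathcal V$ let $\mathsf{Rep}(M)$ be the category of pairs $(X,\alpha)$ with $X\in\mathcal C$ and $\alpha\colon M\to[X,X]$ a map of monoids; a map $(X,\alpha)\to(Y,\beta)$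 is a map $f\colon X\to Y$ in $\mathcal C$ with $f_*\alpha=f^*\beta\colon M\to[X,Y]$. With the forgetful functors $U_M\colon\mathsf{Rep}(M)\to\mathcal C$ and restriction along maps of monoids this is a functor $\mathsf{Rep}\colon\mathsf{Mon}(\mathcal V)\to(\widehat{\mathsf{Cat}}/\mathcal C)^{op}$, where $\widehat{\mathsf{Cat}}$ is the category of categories with a large set of objects (and small hom-sets) and functors, and the slice is the strict one. Let $\mathsf{Acc}$ be the subcategory of $\widehat{\mathsf{Cat}}$ of accessible categories and accessible functors. Call universe enlargement a fully faithful strong monoidal functor $\iota\colon\mathcal V\to\widehat{\mathcal V}$ that preserves small limits, where $\widehat{\mathcal V}$ is a monoidal category with large hom-sets and all large limits. For a functor $F\colon\mathcal D\to\mathcal C$ in $\widehat{\mathsf{Cat}}/\mathcal C$ let $\widehat{\mathscr E}(F)=\int_{D\in\mathcal D}\iota[FD,FD]$ be the end computed in $\widehat{\mathcal V}$, with the monoid structure for which the projections $\pi_D\colon\widehat{\mathscr E}(F)\to\iota[FD,FD]$ are maps of monoids; this gives a functor $\widehat{\mathscr E}\colon(\widehat{\mathsf{Cat}}/\mathcal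 C)^{op}\to\mathsf{Mon}(\widehat{\mathcal V})$. Then the adjunction $\mathsf{Rep}\dashv\mathscr E$ restricts to small monoids and accessible categories over $\mathcal C$, that is: 1. for every monoid $M$ in $\mathcal V$ the category $\mathsf{Rep}(M)$ and the functor $U_M$ are accessible, and for every map of monoids $M\to N$ in $\mathcal V$ the functor $\mathsf{Rep}(N)\to\mathsf{Rep}(M)$ is accessible, so that $\mathsf{Rep}$ takes values in $(\mathsf{Acc}/\mathcal C)^{op}$; 2. the resulting functor $\mathsf{Rep}\colon\mathsf{Mon}(\mathcal V)\to(\mathsf{Acc}/\mathcal C)^{op}$ has a right adjoint $\mathscr E\colon(\mathsf{Acc}/\mathcal C)^{op}\to\mathsf{Mon}(\mathcal V)$; 3. for every universe enlargement $\iota\colon\mathcal V\to\widehat{\mathcal V}$ there is an isomorphism $e_F\colon\iota\,\mathscr E(F)\cong\widehat{\mathscr E}(F)$ of monoids in $\widehat{\mathcal V}$, natural in $F\in(\mathsf{Acc}/\mathcal C)^{op}$, under which the unit $\eta_M\colon M\to\mathscr E(U_M)$ is the canonical map: $\pi_{(X,\alpha)}\circ e_{U_M}\circ\iota(\eta_M)=\iota(\alpha)$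 for every $(X,\alpha)\in\mathsf{Rep}(M)$. -/

import Mathlib

open CategoryTheory Category Limits MonoidalCategory Opposite

universe w v v' v'' u u' u'' u₁ u₂ u₃

noncomputable section

namespace EndRep

/-! ### Auxiliary identities for the hom objects of an enriched category -/

section EnrichedHom

variable (V : Type u') [Category.{v'} V] [MonoidalCategory V]
  {C : Type u} [Category.{v} C] [EnrichedOrdinaryCategory V C]

lemma eId_whiskerLeft {X Y : C} (f : X ⟶ Y) :
    eId V X ≫ eHomWhiskerLeft V X f = eHomEquiv V f := by
  have h := eHomEquiv_comp V (𝟙 X) f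
  rw [id_comp, eHomEquiv_id, MonoidalCategory.tensorHom_def] at h
  rw [h, eHomWhiskerLeft, rightUnitor_inv_naturality_assoc, unitors_inv_equal, assoc]

lemma eId_whiskerRight {X Y : C} (f : X ⟶ Y) :
    eId V Y ≫ eHomWhiskerRight V f Y = eHomEquiv V f := by
  have h := eHomEquiv_comp V f (𝟙 Y)
  rw [comp_id, eHomEquiv_id, tensorHom_def'] at h
  rw [h, eHomWhiskerRight, leftUnitor_inv_naturality_assoc]
  simp

/-- Composition is dinatural in the middle variable. -/
lemma eComp_middle (X : C) {Y Y' : C} (f : Y ⟶ Y') (Z : C) :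
    eHomWhiskerLeft V X f ▷ (Y' ⟶[V] Z) ≫ eComp V X Y' Z =
      (X ⟶[V] Y) ◁ eHomWhiskerRight V f Z ≫ eComp V X Y Z := by
  dsimp [eHomWhiskerLeft, eHomWhiskerRight]
  simp only [comp_whiskerRight, MonoidalCategory.whiskerLeft_comp, assoc, ← e_assoc']
  simp

end EnrichedHom

/-! ### Representations of a monoid -/

section Rep

variable {V : Type u'} [Category.{v'} V] [MonoidalCategory V]
  {C : Type u} [Category.{v} C] [EnrichedOrdinaryCategory V C]

variable (V) in
/-- The endomorphism monoid `[X, X]` of an object `X`. Composition in an enriched category is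
written `[X, Y] ⊗ [Y, Z] ⟶ [X, Z]`; the convention `[Y, Z] ⊗ [X, Y] ⟶ [X, Z]` is the same notion
for the reverse tensor product on `V`, under which right adjoints to `- ⊗ M` become right adjoints
to `M ⊗ -` as in `MonoidalClosed`, and monoids are the same. -/
abbrev endMon (X : C) : Mon V :=
  { X := X ⟶[V] X
    mon :=
      { one := eId V X
        mul := eComp V X X X
        one_mul := by
          rw [← cancel_epi (λ_ _).inv, e_id_comp, Iso.inv_hom_id]
        mul_one := by
          rw [← cancel_epi (ρ_ _).inv, e_comp_id, Iso.inv_hom_id]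
        mul_assoc := (e_assoc' V X X X X).symm } }

variable (C) in
/-- A representation of `M` in `C`: an object `X` of `C` with a map of monoids `M ⟶ [X, X]`. -/
structure RepObj (M : Mon V) where
  X : C
  act : M ⟶ endMon V X

/-- A map of representations `(X, α) ⟶ (Y, β)`: a map `f : X ⟶ Y` in `C` such that
`f_* ∘ α = f^* ∘ β : M ⟶ [X, Y]`. -/
@[ext]
structure RepHom {M : Mon V} (A B : RepObj C M) where
  f : A.X ⟶ B.X
  comm : A.act.hom ≫ eHomWhiskerLeft V A.X f = B.act.hom ≫ eHomWhiskerRight V f B.X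

/-- The category `Rep M` of representations of `M` in `C`. -/
instance (M : Mon V) : Category (RepObj C M) where
  Hom A B := RepHom A B
  id A := ⟨𝟙 A.X, by simp⟩
  comp {A B D} g h := ⟨g.f ≫ h.f, by
    rw [eHomWhiskerLeft_comp, eHomWhiskerRight_comp, ← assoc, g.comm, ← assoc (D.act.hom),
      ← h.comm, assoc, assoc, eHom_whisker_exchange]⟩
  id_comp _ := RepHom.ext (id_comp _)
  comp_id _ := RepHom.ext (comp_id _)
  assoc _ _ _ := RepHom.ext (assoc _ _ _)

variable (C) in
/-- The forgetful functor `Rep M ⥤ C`. -/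
def repForget (M : Mon V) : RepObj C M ⥤ C where
  obj A := A.X
  map g := g.f

variable (C) in
/-- The functor `Rep N ⥤ Rep M` over `C` given by restriction along `ψ : M ⟶ N`. -/
def repRestrict {M N : Mon V} (ψ : M ⟶ N) : RepObj C N ⥤ RepObj C M where
  obj A := ⟨A.X, ψ ≫ A.act⟩
  map {A B} g := ⟨g.f, by
    simpa only [Mon.comp_hom', assoc] using congrArg (fun k => ψ.hom ≫ k) g.comm⟩

lemma repHom_heq {M : Mon V} {A A' B B' : RepObj C M} (hA : A = A') (hB : B = B')
    (g : A ⟶ B) (g' : A' ⟶ B') (h : HEq g.f g'.f) : HEq g g' := by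
  subst hA hB
  exact heq_of_eq (RepHom.ext (eq_of_heq h))

lemma repRestrict_id (M : Mon V) : repRestrict C (𝟙 M) = 𝟭 (RepObj C M) := by
  have h (A : RepObj C M) : (repRestrict C (𝟙 M)).obj A = A :=
    congrArg (RepObj.mk A.X) (id_comp A.act)
  exact CategoryTheory.Functor.hext h
    (fun A B g => repHom_heq (h A) (h B) ((repRestrict C (𝟙 M)).map g) g HEq.rfl)

lemma repRestrict_comp {M N P : Mon V} (ψ : M ⟶ N) (χ : N ⟶ P) :
    repRestrict C (ψ ≫ χ) = repRestrict C χ ⋙ repRestrict C ψ := by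
  have h (A : RepObj C P) :
      (repRestrict C (ψ ≫ χ)).obj A = (repRestrict C χ ⋙ repRestrict C ψ).obj A :=
    congrArg (RepObj.mk A.X) (assoc ψ χ A.act)
  exact CategoryTheory.Functor.hext h (fun A B g => repHom_heq (h A) (h B)
    ((repRestrict C (ψ ≫ χ)).map g) ((repRestrict C χ ⋙ repRestrict C ψ).map g) HEq.rfl)

end Rep

/-! ### The representation functor with values in large categories over `C` -/

section RepFunctor

variable (V : Type (max u (w + 1))) [Category.{w} V] [MonoidalCategory V]
  (C : Type (max u (w + 1))) [Category.{w} C] [EnrichedOrdinaryCategory V C]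

/-- The functor `Rep : Mon V ⥤ (Cat / C)ᵒᵖ` sending `M` to the forgetful functor
`Rep M ⥤ C`. -/
def repFunctor : Mon V ⥤ (Over (Cat.of.{w, max u (w + 1)} C))ᵒᵖ where
  obj M := op (Over.mk (repForget C M).toCatHom)
  map ψ := Quiver.Hom.op (Over.homMk (repRestrict C ψ).toCatHom rfl)
  map_id M := Quiver.Hom.unop_inj (Over.OverMorphism.ext (Cat.ext (repRestrict_id M)))
  map_comp ψ χ :=
    Quiver.Hom.unop_inj (Over.OverMorphism.ext (Cat.ext (repRestrict_comp ψ χ)))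

end RepFunctor

/-! ### Accessible categories over `C` -/

set_option linter.checkUnivs false in
/-- An accessible category (with objects in `Type u` and small sets of morphisms). -/
structure AccCat where
  carrier : Type u
  [cat : Category.{w} carrier]
  [acc : IsAccessibleCategory.{w} carrier]

attribute [instance] AccCat.cat AccCat.acc

lemma isAccessible_id (D : Type u) [Category.{v} D] : (𝟭 D).IsAccessible.{w} := by
  have : Fact Cardinal.aleph0.{w}.IsRegular := Cardinal.fact_isRegular_aleph0
  exact ⟨Cardinal.aleph0, inferInstance, inferInstance⟩

/-- The category `Acc` of accessible categories and accessible functors. -/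
instance : Category AccCat.{w, u} where
  Hom A B := { F : A.carrier ⥤ B.carrier // F.IsAccessible.{w} }
  id A := ⟨𝟭 A.carrier, isAccessible_id A.carrier⟩
  comp F G := ⟨F.1 ⋙ G.1, by have := F.2; have := G.2; infer_instance⟩

/-- An accessible functor, as a morphism of `Acc`. -/
def accHom {A B : Type u} [Category.{w} A] [Category.{w} B] [IsAccessibleCategory.{w} A]
    [IsAccessibleCategory.{w} B] (F : A ⥤ B) (hF : F.IsAccessible.{w}) :
    AccCat.mk.{w, u} A ⟶ AccCat.mk.{w, u} B :=
  ⟨F, hF⟩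

/-- The inclusion of `Acc` in the category of large categories. -/
def accForget : AccCat.{w, u} ⥤ Cat.{w, u} where
  obj A := Cat.of A.carrier
  map F := F.1.toCatHom

/-- The induced functor `Acc / C ⥤ Cat / C`. -/
def accOverForget (C : Type u) [Category.{w} C] [IsAccessibleCategory.{w} C] :
    Over (AccCat.mk.{w, u} C) ⥤ Over (Cat.of.{w, u} C) :=
  Over.post accForget

section RepAcc

variable (V : Type (max u (w + 1))) [Category.{w} V] [MonoidalCategory V]
  (C : Type (max u (w + 1))) [Category.{w} C] [EnrichedOrdinaryCategory V C]

/-- The functor `Rep : Mon V ⥤ (Cat / C)ᵒᵖ` takes values in `(Acc / C)ᵒᵖ`. -/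
structure RepIsAccessible : Prop where
  obj (M : Mon V) : IsAccessibleCategory.{w} (RepObj C M)
  forget (M : Mon V) : (repForget C M).IsAccessible.{w}
  map {M N : Mon V} (ψ : M ⟶ N) : (repRestrict C ψ).IsAccessible.{w}

variable {V C}

/-- The forgetful functor `Rep M ⥤ C` as an object of `Acc / C`. -/
def RepIsAccessible.over [IsAccessibleCategory.{w} C] (h : RepIsAccessible.{w, u} V C)
    (M : Mon V) : Over (AccCat.mk.{w, max u (w + 1)} C) :=
  letI := h.obj M
  Over.mk (accHom (repForget C M) (h.forget M))

/-- The corestriction `Rep : Mon V ⥤ (Acc / C)ᵒᵖ`, when it exists. -/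
def RepIsAccessible.functor [IsAccessibleCategory.{w} C] (h : RepIsAccessible.{w, u} V C) :
    Mon V ⥤ (Over (AccCat.mk.{w, max u (w + 1)} C))ᵒᵖ where
  obj M := op (h.over M)
  map {M N} ψ :=
    letI := h.obj M
    letI := h.obj N
    Quiver.Hom.op (Over.homMk (U := h.over N) (V := h.over M)
      (accHom (repRestrict C ψ) (h.map ψ)) rfl)
  map_id M := Quiver.Hom.unop_inj (Over.OverMorphism.ext (Subtype.ext (repRestrict_id M)))
  map_comp ψ χ :=
    Quiver.Hom.unop_inj (Over.OverMorphism.ext (Subtype.ext (repRestrict_comp ψ χ)))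

lemma RepIsAccessible.functor_comp [IsAccessibleCategory.{w} C]
    (h : RepIsAccessible.{w, u} V C) :
    h.functor ⋙ (accOverForget C).op = repFunctor.{w, u} V C := rfl

end RepAcc

/-! ### The endomorphism monoid of a functor -/

section Aux

variable {W : Type u''} [Category.{v''} W] [MonoidalCategory W] {E A : W} [MonObj A]
  (o : 𝟙_ W ⟶ E) (m : E ⊗ E ⟶ E) (p : E ⟶ A)

lemma aux_one_mul (ho : o ≫ p = MonObj.one) (hm : m ≫ p = (p ⊗ₘ p) ≫ MonObj.mul) :
    (o ▷ E ≫ m) ≫ p = (λ_ E).hom ≫ p := by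
  rw [assoc, hm, ← tensorHom_id, tensorHom_comp_tensorHom_assoc, ho, id_comp, MonObj.one_mul_hom]

lemma aux_mul_one (ho : o ≫ p = MonObj.one) (hm : m ≫ p = (p ⊗ₘ p) ≫ MonObj.mul) :
    (E ◁ o ≫ m) ≫ p = (ρ_ E).hom ≫ p := by
  rw [assoc, hm, ← id_tensorHom, tensorHom_comp_tensorHom_assoc, ho, id_comp, MonObj.mul_one_hom]

lemma aux_mul_assoc (hm : m ≫ p = (p ⊗ₘ p) ≫ MonObj.mul) :
    (m ▷ E ≫ m) ≫ p = ((α_ E E E).hom ≫ E ◁ m ≫ m) ≫ p := by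
  have h₁ : m ▷ E ≫ (p ⊗ₘ p) = ((p ⊗ₘ p) ⊗ₘ p) ≫ MonObj.mul ▷ A := by
    rw [← tensorHom_id, ← tensorHom_id, tensorHom_comp_tensorHom, tensorHom_comp_tensorHom, hm,
      id_comp, comp_id]
  have h₂ : E ◁ m ≫ (p ⊗ₘ p) = (p ⊗ₘ (p ⊗ₘ p)) ≫ A ◁ MonObj.mul := by
    rw [← id_tensorHom, ← id_tensorHom, tensorHom_comp_tensorHom, tensorHom_comp_tensorHom, hm,
      id_comp, comp_id]
  simp only [assoc, hm]
  rw [← assoc, h₁, reassoc_of% h₂, assoc, MonObj.mul_assoc, associator_naturality_assoc]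

lemma aux_lift_mul {M : W} (l : M ⟶ E) (g : M ⟶ A) (hl : l ≫ p = g) :
    (g ⊗ₘ g) ≫ MonObj.mul = (l ⊗ₘ l) ≫ (p ⊗ₘ p) ≫ MonObj.mul := by
  rw [tensorHom_comp_tensorHom_assoc, hl]

end Aux

section Endo

variable {V : Type u'} [Category.{v'} V] [MonoidalCategory V]
  {C : Type u} [Category.{v} C] [EnrichedOrdinaryCategory V C]
  {W : Type u''} [Category.{v''} W] [MonoidalCategory W] (ι : V ⥤ W) [ι.LaxMonoidal]

lemma aux_condition {E : W} {A B : C} (f : A ⟶ B) (p : E ⟶ ι.obj (A ⟶[V] A))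
    (q : E ⟶ ι.obj (B ⟶[V] B))
    (h : p ≫ ι.map (eHomWhiskerLeft V A f) = q ≫ ι.map (eHomWhiskerRight V f B)) :
    ((p ⊗ₘ p) ≫ (Functor.LaxMonoidal.μ ι _ _ ≫ ι.map (eComp V A A A))) ≫
        ι.map (eHomWhiskerLeft V A f) =
      ((q ⊗ₘ q) ≫ (Functor.LaxMonoidal.μ ι _ _ ≫ ι.map (eComp V B B B))) ≫
        ι.map (eHomWhiskerRight V f B) := by
  have h₁ : (p ⊗ₘ (p ≫ ι.map (eHomWhiskerLeft V A f))) ≫ Functor.LaxMonoidal.μ ι _ _ ≫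
        ι.map (eComp V A A B) =
      ((p ⊗ₘ p) ≫ (Functor.LaxMonoidal.μ ι _ _ ≫ ι.map (eComp V A A A))) ≫
        ι.map (eHomWhiskerLeft V A f) := by
    simp only [assoc]
    rw [← ι.map_comp, eComp_eHomWhiskerLeft, ι.map_comp,
      ← Functor.LaxMonoidal.μ_natural_right_assoc, ← id_tensorHom, tensorHom_comp_tensorHom_assoc,
      comp_id]
  have h₂ : ((q ≫ ι.map (eHomWhiskerRight V f B)) ⊗ₘ q) ≫ Functor.LaxMonoidal.μ ι _ _ ≫
        ι.map (eComp V A B B) =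
      ((q ⊗ₘ q) ≫ (Functor.LaxMonoidal.μ ι _ _ ≫ ι.map (eComp V B B B))) ≫
        ι.map (eHomWhiskerRight V f B) := by
    simp only [assoc]
    rw [← ι.map_comp, eComp_eHomWhiskerRight, ι.map_comp,
      ← Functor.LaxMonoidal.μ_natural_left_assoc, ← tensorHom_id, tensorHom_comp_tensorHom_assoc,
      comp_id]
  rw [← h₁, ← h₂, h, ← h]
  have h₃ : (p ⊗ₘ (q ≫ ι.map (eHomWhiskerRight V f B))) =
      (p ⊗ₘ q) ≫ _ ◁ ι.map (eHomWhiskerRight V f B) := by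
    rw [← id_tensorHom, tensorHom_comp_tensorHom, comp_id]
  have h₄ : ((p ≫ ι.map (eHomWhiskerLeft V A f)) ⊗ₘ q) =
      (p ⊗ₘ q) ≫ ι.map (eHomWhiskerLeft V A f) ▷ _ := by
    rw [← tensorHom_id, tensorHom_comp_tensorHom, comp_id]
  rw [h, h₃, ← h, h₄, assoc, assoc, Functor.LaxMonoidal.μ_natural_right_assoc,
    Functor.LaxMonoidal.μ_natural_left_assoc, ← ι.map_comp, ← ι.map_comp, eComp_middle]

/-- The bifunctor `(d, d') ↦ ι [F d, F d']`. -/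
@[simps]
def homBifunctor {D : Type u₁} [Category.{v} D] (F : D ⥤ C) : Dᵒᵖ ⥤ D ⥤ W where
  obj d :=
    { obj := fun d' => ι.obj (F.obj d.unop ⟶[V] F.obj d')
      map := fun g => ι.map (eHomWhiskerLeft V (F.obj d.unop) (F.map g))
      map_id := by simp
      map_comp := by simp }
  map g :=
    { app := fun d' => ι.map (eHomWhiskerRight V (F.map g.unop) (F.obj d'))
      naturality := by
        intro d' d'' k
        simp only [← ι.map_comp, eHom_whisker_exchange] }
  map_id d := by ext; simp
  map_comp g k := by ext; simp

variable {D : Type u₁} [Category.{v} D] (F : D ⥤ C) [HasEnd (homBifunctor ι F)]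

/-- The underlying object of the endomorphism monoid of `F`: the end of `ι [F -, F -]`. For
`ι : V ⥤ W` an enlargement of the universe, this is the object of `V`-natural transformations
of `F`, computed in `W`. -/
abbrev endoObj : W := end_ (homBifunctor ι F)

/-- The projection of the endomorphism object of `F` on `ι [F d, F d]`, which underlies a monoid
in `W` since `ι` is lax monoidal. -/
abbrev endoProj (d : D) : endoObj ι F ⟶ (ι.mapMon.obj (endMon V (F.obj d))).X :=
  end_.π (homBifunctor ι F) d

lemma endoProj_condition {i j : D} (f : i ⟶ j) :
    endoProj ι F i ≫ ι.map (eHomWhiskerLeft V (F.obj i) (F.map f)) =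
      endoProj ι F j ≫ ι.map (eHomWhiskerRight V (F.map f) (F.obj j)) :=
  end_.condition (homBifunctor ι F) f

/-- The unit of the endomorphism monoid: in each component, it is the unit of `ι [F d, F d]`. -/
def endoOne : 𝟙_ W ⟶ endoObj ι F :=
  end_.lift (F := homBifunctor ι F)
    (fun d => MonObj.one (X := (ι.mapMon.obj (endMon V (F.obj d))).X)) (by
    intro i j f
    change (Functor.LaxMonoidal.ε ι ≫ ι.map (eId V (F.obj i))) ≫
        ι.map (eHomWhiskerLeft V (F.obj i) (F.map f)) =
      (Functor.LaxMonoidal.ε ι ≫ ι.map (eId V (F.obj j))) ≫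
        ι.map (eHomWhiskerRight V (F.map f) (F.obj j))
    rw [assoc, assoc, ← ι.map_comp, ← ι.map_comp, eId_whiskerLeft, eId_whiskerRight])

lemma endoOne_proj (d : D) : endoOne ι F ≫ endoProj ι F d = MonObj.one :=
  end_.lift_π (F := homBifunctor ι F) _ _ d

/-- The multiplication of the endomorphism monoid: in each component, it is the multiplication
of `ι [F d, F d]`. -/
def endoMul : endoObj ι F ⊗ endoObj ι F ⟶ endoObj ι F :=
  end_.lift (F := homBifunctor ι F)
    (fun d => (endoProj ι F d ⊗ₘ endoProj ι F d) ≫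
      MonObj.mul (X := (ι.mapMon.obj (endMon V (F.obj d))).X)) (by
    intro i j f
    exact aux_condition ι (F.map f) _ _ (endoProj_condition ι F f))

lemma endoMul_proj (d : D) :
    endoMul ι F ≫ endoProj ι F d = (endoProj ι F d ⊗ₘ endoProj ι F d) ≫ MonObj.mul :=
  end_.lift_π (F := homBifunctor ι F) _ _ d

/-- The endomorphism monoid of `F : D ⥤ C`, computed in `W`. -/
def endo : Mon W where
  X := endoObj ι F
  mon :=
    { one := endoOne ι F
      mul := endoMul ι F
      one_mul := by
        refine end_.hom_ext (F := homBifunctor ι F) (fun d => ?_)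
        exact aux_one_mul (A := (ι.mapMon.obj (endMon V (F.obj d))).X) _ _ _ (endoOne_proj ι F d) (endoMul_proj ι F d)
      mul_one := by
        refine end_.hom_ext (F := homBifunctor ι F) (fun d => ?_)
        exact aux_mul_one (A := (ι.mapMon.obj (endMon V (F.obj d))).X) _ _ _ (endoOne_proj ι F d) (endoMul_proj ι F d)
      mul_assoc := by
        refine end_.hom_ext (F := homBifunctor ι F) (fun d => ?_)
        exact aux_mul_assoc (A := (ι.mapMon.obj (endMon V (F.obj d))).X) _ _ (endoMul_proj ι F d) }

/-- The projection of the endomorphism monoid of `F` on `ι [F d, F d]`, as a map of monoids. -/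
def endoπ (d : D) : endo ι F ⟶ ι.mapMon.obj (endMon V (F.obj d)) :=
  Mon.Hom.mk' (endoProj ι F d) (endoOne_proj ι F d) (endoMul_proj ι F d)

variable {ι F} in
lemma endo_hom_ext {M : Mon W} {f g : M ⟶ endo ι F}
    (h : ∀ d, f ≫ endoπ ι F d = g ≫ endoπ ι F d) : f = g :=
  Mon.Hom.ext (end_.hom_ext (F := homBifunctor ι F)
    (fun d => congrArg Mon.Hom.hom (h d)))

/-- Maps of monoids to the endomorphism monoid of `F` are compatible families of maps of monoids
to the `ι [F d, F d]`. -/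
def endoLift {M : Mon W} (f : ∀ d, M ⟶ ι.mapMon.obj (endMon V (F.obj d)))
    (hf : ∀ ⦃i j : D⦄ (g : i ⟶ j),
      (f i).hom ≫ ι.map (eHomWhiskerLeft V (F.obj i) (F.map g)) =
        (f j).hom ≫ ι.map (eHomWhiskerRight V (F.map g) (F.obj j))) :
    M ⟶ endo ι F :=
  have hl (d : D) : end_.lift (F := homBifunctor ι F) (fun d => (f d).hom) (fun _ _ g => hf g) ≫
      endoProj ι F d = (f d).hom := end_.lift_π (F := homBifunctor ι F) _ _ d
  Mon.Hom.mk' (end_.lift (F := homBifunctor ι F) (fun d => (f d).hom) (fun _ _ g => hf g))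
    (by
      refine end_.hom_ext (F := homBifunctor ι F) (fun d => ?_)
      refine (assoc _ _ _).trans ((congrArg (fun k => MonObj.one ≫ k) (hl d)).trans ?_)
      exact (IsMonHom.one_hom (f d).hom).trans (endoOne_proj ι F d).symm)
    (by
      refine end_.hom_ext (F := homBifunctor ι F) (fun d => ?_)
      refine (assoc _ _ _).trans ((congrArg (fun k => MonObj.mul ≫ k) (hl d)).trans ?_)
      refine (IsMonHom.mul_hom (f d).hom).trans ?_
      refine Eq.trans ?_ (assoc _ _ _).symm
      refine Eq.trans ?_ (congrArg (fun k => _ ≫ k) (endoMul_proj ι F d)).symm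
      exact aux_lift_mul (A := (ι.mapMon.obj (endMon V (F.obj d))).X) _ _ _ (hl d))

lemma endoLift_π {M : Mon W} (f : ∀ d, M ⟶ ι.mapMon.obj (endMon V (F.obj d)))
    (hf : ∀ ⦃i j : D⦄ (g : i ⟶ j),
      (f i).hom ≫ ι.map (eHomWhiskerLeft V (F.obj i) (F.map g)) =
        (f j).hom ≫ ι.map (eHomWhiskerRight V (F.map g) (F.obj j))) (d : D) :
    endoLift ι F f hf ≫ endoπ ι F d = f d :=
  Mon.Hom.ext (end_.lift_π (F := homBifunctor ι F) (fun d => (f d).hom) (fun _ _ g => hf g) d)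

variable {D' : Type u₂} [Category.{v} D'] (Φ : D' ⥤ D) {F' : D' ⥤ C} (h : Φ ⋙ F = F')
    [HasEnd (homBifunctor ι F')]

/-- The map of endomorphism monoids induced by `Φ : D' ⥤ D` over `C`. Its components are
`endo ι F ⟶ ι [F (Φ d), F (Φ d)] = ι [F' d, F' d]`. -/
def endoMap : endo ι F ⟶ endo ι F' :=
  endoLift ι F'
    (fun d => endoπ ι F (Φ.obj d) ≫
      eqToHom (congrArg (fun X => ι.mapMon.obj (endMon V X)) (Functor.congr_obj h d)))
    (by
      subst h
      intro i j g
      rw [eqToHom_refl, eqToHom_refl, comp_id, comp_id]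
      exact endoProj_condition ι F (Φ.map g))

lemma endoMap_π (d : D') : endoMap ι F Φ h ≫ endoπ ι F' d =
    endoπ ι F (Φ.obj d) ≫
      eqToHom (congrArg (fun X => ι.mapMon.obj (endMon V X)) (Functor.congr_obj h d)) :=
  endoLift_π ι F' _ _ d

lemma endoMap_id (h : 𝟭 D ⋙ F = F) : endoMap ι F (𝟭 D) h = 𝟙 (endo ι F) :=
  endo_hom_ext (fun d => by
    rw [endoMap_π, eqToHom_refl, id_comp]
    exact comp_id _)

lemma endoMap_comp {D'' : Type u₃} [Category.{v} D''] (Ψ : D'' ⥤ D') {F'' : D'' ⥤ C}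
    (h' : Ψ ⋙ F' = F'') [HasEnd (homBifunctor ι F'')] (h'' : (Ψ ⋙ Φ) ⋙ F = F'') :
    endoMap ι F (Ψ ⋙ Φ) h'' = endoMap ι F Φ h ≫ endoMap ι F' Ψ h' := by
  subst h h'
  exact endo_hom_ext (fun d => by
    have h₁ := endoMap_π ι F Φ rfl (Ψ.obj d)
    have h₂ := endoMap_π ι (Φ ⋙ F) Ψ rfl d
    have h₃ := endoMap_π ι F (Ψ ⋙ Φ) h'' d
    rw [eqToHom_refl] at h₁ h₂ h₃
    refine (h₃.trans (comp_id _)).trans ?_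
    rw [assoc]
    refine Eq.trans ?_ (congrArg (fun k => endoMap ι F Φ rfl ≫ k) (h₂.trans (comp_id _))).symm
    exact (h₁.trans (comp_id _)).symm)

end Endo

/-- The functor `D ⥤ C` underlying an object of `Cat / C`. -/
abbrev overFunctor {C : Type u} [Category.{w} C] (F : Over (Cat.of.{w, u} C)) : F.left ⥤ C :=
  F.hom.toFunctor

/-- The functor `(Cat / C)ᵒᵖ ⥤ Mon W` sending `F : D ⥤ C` to its endomorphism monoid, the end
of `ι [F -, F -]`. -/
def endoFunctor {V : Type u'} [Category.{v'} V] [MonoidalCategory V]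
    (C : Type u) [Category.{w} C] [EnrichedOrdinaryCategory V C]
    {W : Type u''} [Category.{max u w} W] [MonoidalCategory W]
    [HasLimitsOfSize.{max u w, max u w} W] (ι : V ⥤ W) [ι.LaxMonoidal] :
    (Over (Cat.of.{w, u} C))ᵒᵖ ⥤ Mon W where
  obj F := endo ι (overFunctor F.unop)
  map {F F'} Φ := endoMap ι (overFunctor F.unop) Φ.unop.left.toFunctor
    (F' := overFunctor F'.unop) (congrArg Cat.Hom.toFunctor (Over.w Φ.unop))
  map_id F := endoMap_id ι (overFunctor F.unop) _
  map_comp {F _ _} Φ Ψ := endoMap_comp ι (overFunctor F.unop) Φ.unop.left.toFunctor _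
    Ψ.unop.left.toFunctor _ _

/-! ### Tensored enrichments -/

section Tensor

variable (V : Type u') [Category.{v'} V] [MonoidalCategory V] [MonoidalClosed V]
  {C : Type u} [Category.{v} C] [EnrichedOrdinaryCategory V C]

/-- The action of the hom objects of `C` on `Y ↦ [X, Y]^M`, where `(-)^M` is the right adjoint
of `M ⊗ -`; it makes `Y ↦ [X, Y]^M` a `V`-functor from `C` to `V`. -/
def powerAction (M : V) (X Y Z : C) :
    (ihom M).obj (X ⟶[V] Y) ⊗ (Y ⟶[V] Z) ⟶ (ihom M).obj (X ⟶[V] Z) :=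
  MonoidalClosed.curry ((α_ _ _ _).inv ≫ (ihom.ev M).app (X ⟶[V] Y) ▷ (Y ⟶[V] Z) ≫
    eComp V X Y Z)

/-- A tensor of `M : V` and `X : C`: an object `M ⊗ X` of `C` with a `V`-natural isomorphism
`[M ⊗ X, Y] ≅ [X, Y]^M`, that is, a `V`-representation of `Y ↦ [X, Y]^M`. -/
structure Tensor (M : V) (X : C) where
  obj : C
  iso (Y : C) : (obj ⟶[V] Y) ≅ (ihom M).obj (X ⟶[V] Y)
  natural (Y Z : C) :
    eComp V obj Y Z ≫ (iso Z).hom = (iso Y).hom ▷ (Y ⟶[V] Z) ≫ powerAction V M X Y Z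

namespace Tensor

variable {V} {M : V} {X : C} (T : Tensor V M X)

/-- The universal map `M ⟶ [X, M ⊗ X]`. -/
def unit : M ⟶ (X ⟶[V] T.obj) :=
  (ρ_ M).inv ≫ MonoidalClosed.uncurry (eId V T.obj ≫ (T.iso T.obj).hom)

/-- The bijection between maps `M ⊗ X ⟶ Y` in `C` and maps `M ⟶ [X, Y]` in `V`. -/
def homEquiv (Y : C) : (T.obj ⟶ Y) ≃ (M ⟶ (X ⟶[V] Y)) :=
  (eHomEquiv V).trans <| ((T.iso Y).homToEquiv).trans <|
    ((ihom.adjunction M).homEquiv _ _).symm.trans (ρ_ M).homFromEquiv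

lemma whiskerLeft_iso {Y Z : C} (f : Y ⟶ Z) :
    eHomWhiskerLeft V T.obj f ≫ (T.iso Z).hom =
      (T.iso Y).hom ≫ (ihom M).map (eHomWhiskerLeft V X f) := by
  have h : (ρ_ _).inv ≫ _ ◁ eHomEquiv V f ≫ powerAction V M X Y Z =
      (ihom M).map (eHomWhiskerLeft V X f) := by
    apply MonoidalClosed.uncurry_injective
    rw [MonoidalClosed.uncurry_ihom_map, ← assoc, MonoidalClosed.uncurry_natural_left, powerAction,
      MonoidalClosed.uncurry_curry, eHomWhiskerLeft]
    simp only [MonoidalCategory.whiskerLeft_comp, assoc]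
    rw [associator_inv_naturality_right_assoc, whisker_exchange_assoc]
    have key {H K L : V} (e : M ⊗ H ⟶ K) (k : K ⊗ 𝟙_ V ⟶ L) :
        M ◁ (ρ_ H).inv ≫ (α_ M H (𝟙_ V)).inv ≫ e ▷ 𝟙_ V ≫ k = e ≫ (ρ_ K).inv ≫ k := by
      rw [rightUnitor_inv_naturality_assoc, rightUnitor_tensor_inv, assoc]
    exact key _ _
  rw [← h, eHomWhiskerLeft, assoc, assoc, T.natural, whisker_exchange_assoc,
    rightUnitor_inv_naturality_assoc]

lemma homEquiv_apply {Y : C} (f : T.obj ⟶ Y) :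
    T.homEquiv Y f = T.unit ≫ eHomWhiskerLeft V X f := by
  change (ρ_ M).inv ≫ MonoidalClosed.uncurry (eHomEquiv V f ≫ (T.iso Y).hom) = _
  rw [← eId_whiskerLeft, assoc, whiskerLeft_iso, ← assoc, MonoidalClosed.uncurry_natural_right,
    unit, assoc]

end Tensor

variable (C) in
/-- `C` is tensored over `V`: a choice of all tensors. -/
structure Tensoring where
  tensor (M : V) (X : C) : Tensor V M X

variable {V} in
/-- The functor `X ↦ M ⊗ X`: it sends `f : X ⟶ X'` to the map `M ⊗ X ⟶ M ⊗ X'` corresponding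
to `M ⟶ [X', M ⊗ X'] ⟶ [X, M ⊗ X']`. -/
def Tensoring.functor (t : Tensoring V C) (M : V) : C ⥤ C where
  obj X := (t.tensor M X).obj
  map {X X'} f := ((t.tensor M X).homEquiv _).symm
    ((t.tensor M X').unit ≫ eHomWhiskerRight V f _)
  map_id X := by
    rw [Equiv.symm_apply_eq, Tensor.homEquiv_apply, eHomWhiskerRight_id, eHomWhiskerLeft_id]
  map_comp {X X' X''} f g := by
    rw [Equiv.symm_apply_eq, Tensor.homEquiv_apply, eHomWhiskerLeft_comp, ← assoc,
      ← Tensor.homEquiv_apply, Equiv.apply_symm_apply, assoc, ← eHom_whisker_exchange,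
      ← assoc, ← Tensor.homEquiv_apply, Equiv.apply_symm_apply, assoc, eHomWhiskerRight_comp]

variable (C) in
/-- The accessible category `C` is accessibly tensored over the accessible closed monoidal
category `V`: all tensors `M ⊗ X` exist and every functor `X ↦ M ⊗ X` is accessible. -/
def IsAccessiblyTensored [IsAccessibleCategory.{w} V] [IsAccessibleCategory.{w} C] : Prop :=
  ∃ t : Tensoring V C, ∀ M : V, (t.functor M).IsAccessible.{w}

end Tensor

end EndRep

end

/-! A functor `D ⥤ RepObj C M` over `C` with underlying functor `F` is the same thing as a family of
monoid maps `M ⟶ [F d, F d]` natural in `d`, that is, a monoid map from `M` to the end of `[F -, F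
-]`. The adjunction is therefore formal once this end exists in `V`. What needs proof is that `Rep
M` is accessible, and that an end over a large accessible category reduces to a small one.

Accessibility. Maps `K ⊗ X ⟶ Y` correspond to maps `K ⟶ [X, Y]`, and the axioms of an action involve
only `K = 𝟙, M, M ⊗ M`. A colimit in `C` preserved by these three functors `K ⊗ -` lifts to
representations (`PreservesFor.exists_rep`, `isColimitOfForget`). By `exists_uniform` there are `κ₁
< κ₂` such that the three functors preserve `κ₁`-filtered colimits and `κ₂`-presentable objects. The
core is `exists_rep_of_family`: given a `κ₂`-directed presentation of the object under a
representation `A`, the action is lifted stage by stage along a chain of length `κ₁`, whose colimit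
is a `κ₂`-presentable object carrying an honest action over `A`. Hence the presentable
representations over `A` are `κ₂`-filtered and final among the presentable objects over `A.X`, and
`A` is their colimit.

Ends. If `κ` is large enough for `D`, for `F` and for the functors `K ⊗ -` with `K` in a small
generator of `V`, then `[F d, Y]` is the limit of the `[F k, Y]` over the `κ`-presentable `k`
mapping to `d` (`exists_isHomDense`). So a wedge on `D` is the same as a wedge on the small category
of presentable objects. The end thus exists in `V`, and a functor `ι` preserving small limits
carries it to the end computed in the enlargement (`IsHomDense.isIso_endoCompare`). -/

noncomputable section

namespace EndRep

/-! ### Raising the index of accessibility -/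

section Raising

set_option linter.unusedSectionVars false

open Cardinal CardinalDirectedPoset

/-- There are arbitrarily large regular cardinals which are sharply larger than `κ₁`. -/
lemma exists_regular_cofinal (κ₁ ν : Cardinal.{w}) :
    ∃ κ₂ : Cardinal.{w}, κ₂.IsRegular ∧ κ₁ < κ₂ ∧ ν < κ₂ ∧
      ∀ (X : Type w) (_ : HasCardinalLT X κ₂),
        ∃ (Y : Set (SetCardinalLT κ₁ X)), HasCardinalLT Y κ₂ ∧ IsCofinal Y := by
  -- The witness is the successor of `2 ^ m`. A set with at most `2 ^ m` elements has at most `(2 ^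
  -- m) ^ m = 2 ^ m` subsets of size `< κ₁ ≤ m`, so the whole poset of these subsets serves as its
  -- own cofinal set.
  let m : Cardinal.{w} := max (max κ₁ ν) ℵ₀
  have hm : ℵ₀ ≤ m := le_max_right _ _
  have hm' : m < 2 ^ m := cantor m
  have h₂ : ℵ₀ ≤ 2 ^ m := hm.trans hm'.le
  have hlt : m < Order.succ (2 ^ m) := hm'.trans (Order.lt_succ _)
  have hκ₁ : κ₁ ≤ m := (le_max_left _ _).trans (le_max_left _ _)
  have hν : ν ≤ m := (le_max_right _ _).trans (le_max_left _ _)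
  refine ⟨Order.succ (2 ^ m), isRegular_succ h₂, hκ₁.trans_lt hlt,
    hν.trans_lt hlt, fun X hX => ⟨Set.univ, ?_, IsCofinal.univ⟩⟩
  rw [hasCardinalLT_iff_cardinal_mk_lt, Order.lt_succ_iff] at hX
  rw [hasCardinalLT_iff_cardinal_mk_lt, Order.lt_succ_iff, mk_univ]
  calc #(SetCardinalLT κ₁ X) ≤ #{ t : Set X // #t ≤ m } :=
        mk_subtype_mono
          (fun t ht => ((hasCardinalLT_iff_cardinal_mk_lt _ _).1 ht).le.trans hκ₁)
    _ ≤ max #X ℵ₀ ^ m := mk_bounded_set_le X m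
    _ ≤ (2 ^ m) ^ m := power_le_power_right (max_le hX h₂)
    _ = 2 ^ m := by rw [← power_mul, mul_eq_self hm]

variable (κ₁ κ₂ : Cardinal.{w}) [Fact κ₁.IsRegular] [Fact κ₂.IsRegular]

/-- The condition that any subset of cardinality `< κ₂` of a `κ₁`-directed poset is contained in
a `κ₁`-directed subset of cardinality `< κ₂`. -/
structure IsSharplyLT : Prop where
  lt : κ₁ < κ₂
  exists_set {X : Type w} [PartialOrder X] [IsCardinalFiltered X κ₁]
    (A : Set X) (hA : HasCardinalLT A κ₂) :
    ∃ (B : Set X), A ⊆ B ∧ IsCardinalFiltered B κ₁ ∧ HasCardinalLT B κ₂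

lemma exists_isSharplyLT (κ₁ ν : Cardinal.{w}) [Fact κ₁.IsRegular] :
    ∃ (κ₂ : Cardinal.{w}) (_ : Fact κ₂.IsRegular), ν < κ₂ ∧ IsSharplyLT κ₁ κ₂ := by
  obtain ⟨κ₂, h, h₁, h₂, h₃⟩ := exists_regular_cofinal κ₁ ν
  have : Fact κ₂.IsRegular := ⟨h⟩
  exact ⟨κ₂, this, h₂, h₁,
    SharplyLT.exists_isCardinalFiltered_set_of_exists_cofinal h₁ h₃⟩

/-- The `κ₁`-directed subsets of cardinality `< κ₂` of a poset. -/
abbrev DirectedSubset (I : Type w) [PartialOrder I] : Type w :=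
  { B : Set I // IsCardinalFiltered B κ₁ ∧ HasCardinalLT B κ₂ }

variable {κ₁ κ₂}

instance {I : Type w} [PartialOrder I] (B : DirectedSubset κ₁ κ₂ I) :
    IsCardinalFiltered B.1 κ₁ := B.2.1

lemma IsSharplyLT.exists_mem (h : IsSharplyLT κ₁ κ₂) {I : Type w} [PartialOrder I]
    [IsCardinalFiltered I κ₁] (i : I) : ∃ B : DirectedSubset κ₁ κ₂ I, i ∈ B.1 := by
  obtain ⟨B, hB, h₁, h₂⟩ := h.exists_set {i}
    (hasCardinalLT_of_finite _ _ (IsRegular.aleph0_le Fact.out))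
  exact ⟨⟨B, h₁, h₂⟩, hB rfl⟩

/-- A union of fewer than `κ₂` sets of size `< κ₂` is again of size `< κ₂` by regularity, and
sharpness encloses it in a `κ₁`-directed one. -/
lemma IsSharplyLT.isCardinalFiltered (h : IsSharplyLT κ₁ κ₂) (I : Type w) [PartialOrder I]
    [IsCardinalFiltered I κ₁] : IsCardinalFiltered (DirectedSubset κ₁ κ₂ I) κ₂ :=
  isCardinalFiltered_preorder _ _ (fun K s hK => by
    rw [← hasCardinalLT_iff_cardinal_mk_lt] at hK
    obtain ⟨B, hB, h₁, h₂⟩ := h.exists_set (⋃ k, (s k).1)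
      (hasCardinalLT_iUnion _ hK (fun k => (s k).2.2))
    exact ⟨⟨B, h₁, h₂⟩, fun k => (Set.subset_iUnion (fun k => (s k).1) k).trans hB⟩)

section

variable {C : Type u} [Category.{v} C] [HasCardinalFilteredColimits.{w} C κ₁]
  {I : Type w} [PartialOrder I] (F : I ⥤ C)

/-- The restriction of a diagram to a directed subset. -/
abbrev restrictDiag (B : Set I) : B ⥤ C :=
  (Subtype.mono_coe (· ∈ B)).functor ⋙ F

instance (B : DirectedSubset κ₁ κ₂ I) : HasColimit (restrictDiag F B.1) :=
  have := HasCardinalFilteredColimits.hasColimitsOfShape (κ := κ₁) C B.1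
  inferInstance

/-- The inclusion of a term of the diagram in the colimit of the restricted diagram. -/
abbrev subsetι (B : DirectedSubset κ₁ κ₂ I) (i : I) (hi : i ∈ B.1) :
    F.obj i ⟶ colimit (restrictDiag F B.1) :=
  colimit.ι (restrictDiag F B.1) ⟨i, hi⟩

lemma subsetι_w (B : DirectedSubset κ₁ κ₂ I) {i j : I} (hij : i ≤ j) (hi : i ∈ B.1)
    (hj : j ∈ B.1) : F.map (homOfLE hij) ≫ subsetι F B j hj = subsetι F B i hi :=
  colimit.w (restrictDiag F B.1) (homOfLE (show (⟨i, hi⟩ : B.1) ≤ ⟨j, hj⟩ from hij))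

/-- The maps out of the colimit of a restricted diagram. -/
def subsetDesc (B : DirectedSubset κ₁ κ₂ I) {T : C} (f : ∀ i ∈ B.1, F.obj i ⟶ T)
    (hf : ∀ i j (hi : i ∈ B.1) (hj : j ∈ B.1) (hij : i ≤ j),
      F.map (homOfLE hij) ≫ f j hj = f i hi) :
    colimit (restrictDiag F B.1) ⟶ T :=
  colimit.desc (restrictDiag F B.1)
    { pt := T
      ι := { app := fun i => f i.1 i.2
             naturality := fun i j g => (hf _ _ i.2 j.2 (leOfHom g)).trans (comp_id _).symm } }

lemma subsetι_desc (B : DirectedSubset κ₁ κ₂ I) {T : C} (f : ∀ i ∈ B.1, F.obj i ⟶ T)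
    (hf : ∀ i j (hi : i ∈ B.1) (hj : j ∈ B.1) (hij : i ≤ j),
      F.map (homOfLE hij) ≫ f j hj = f i hi) (i : I) (hi : i ∈ B.1) :
    subsetι F B i hi ≫ subsetDesc F B f hf = f i hi :=
  colimit.ι_desc _ _

lemma subsetι_desc_comp (B : DirectedSubset κ₁ κ₂ I) {T T' : C} (f : ∀ i ∈ B.1, F.obj i ⟶ T)
    (hf : ∀ i j (hi : i ∈ B.1) (hj : j ∈ B.1) (hij : i ≤ j),
      F.map (homOfLE hij) ≫ f j hj = f i hi) (i : I) (hi : i ∈ B.1) (g : T ⟶ T') :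
    subsetι F B i hi ≫ subsetDesc F B f hf ≫ g = f i hi ≫ g := by
  rw [← assoc, subsetι_desc]

lemma subset_hom_ext (B : DirectedSubset κ₁ κ₂ I) {T : C}
    {f g : colimit (restrictDiag F B.1) ⟶ T}
    (h : ∀ i hi, subsetι F B i hi ≫ f = subsetι F B i hi ≫ g) : f = g :=
  colimit.hom_ext (fun i => h i.1 i.2)

/-- The map between colimits over directed subsets. -/
def subsetMap {B B' : DirectedSubset κ₁ κ₂ I} (h : B ≤ B') :
    colimit (restrictDiag F B.1) ⟶ colimit (restrictDiag F B'.1) :=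
  subsetDesc F B (fun i hi => subsetι F B' i (h hi)) (fun _ _ _ _ hij => subsetι_w F B' hij _ _)

lemma subsetι_map_comp {B B' : DirectedSubset κ₁ κ₂ I} (h : B ≤ B') (i : I) (hi : i ∈ B.1) {T : C}
    (f : colimit (restrictDiag F B'.1) ⟶ T) :
    subsetι F B i hi ≫ subsetMap F h ≫ f = subsetι F B' i (h hi) ≫ f :=
  subsetι_desc_comp ..

/-- The diagram of the colimits over directed subsets. -/
def directedDiag : DirectedSubset κ₁ κ₂ I ⥤ C where
  obj B := colimit (restrictDiag F B.1)
  map g := subsetMap F (leOfHom g)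
  map_id B := subset_hom_ext F B (fun i hi => (subsetι_desc ..).trans (comp_id _).symm)
  map_comp g g' := subset_hom_ext F _ (fun i hi => by
    rw [subsetι_map_comp]
    exact (subsetι_desc ..).trans
      (subsetι_desc F _ (fun i hi => subsetι F _ i (leOfHom g' hi)) _ i (leOfHom g hi)).symm)

variable {F} in
/-- The map from the colimit over a directed subset to the point of a cocone. -/
def subsetToPt (c : Cocone F) (B : DirectedSubset κ₁ κ₂ I) :
    colimit (restrictDiag F B.1) ⟶ c.pt :=
  subsetDesc F B (fun i _ => c.ι.app i) (fun _ _ _ _ hij => c.w (homOfLE hij))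

variable {F} in
lemma subsetι_toPt (c : Cocone F) (B : DirectedSubset κ₁ κ₂ I) (i : I) (hi : i ∈ B.1) :
    subsetι F B i hi ≫ subsetToPt c B = c.ι.app i := subsetι_desc ..

variable {F} in
/-- The cocone of the colimits over directed subsets. -/
def directedCocone (c : Cocone F) : Cocone (directedDiag (κ₁ := κ₁) (κ₂ := κ₂) F) where
  pt := c.pt
  ι :=
    { app B := subsetToPt c B
      naturality B B' g := by
        have h : subsetMap F (leOfHom g) ≫ subsetToPt c B' = subsetToPt c B :=
          subset_hom_ext F B (fun i hi => by
            rw [subsetι_map_comp, subsetι_toPt, subsetι_toPt])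
        exact h.trans (comp_id _).symm }

variable {F} in
lemma subsetι_cocone_ι_eq (s : Cocone (directedDiag (κ₁ := κ₁) (κ₂ := κ₂) F))
    {B B' : DirectedSubset κ₁ κ₂ I} (h : B ≤ B') (i : I) (hi : i ∈ B.1) :
    subsetι F B' i (h hi) ≫ s.ι.app B' = subsetι F B i hi ≫ s.ι.app B :=
  (subsetι_map_comp F h i hi (s.ι.app B')).symm.trans
    (congrArg (fun k => subsetι F B i hi ≫ k) (s.w (homOfLE h)))

variable {F} in
/-- A colimit over a `κ₁`-directed poset is the `κ₂`-directed colimit of the colimits over its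
`κ₁`-directed subsets of cardinality `< κ₂`. -/
def isColimitDirectedCocone (h : IsSharplyLT κ₁ κ₂) [IsCardinalFiltered I κ₁] {c : Cocone F}
    (hc : IsColimit c) : IsColimit (directedCocone (κ₁ := κ₁) (κ₂ := κ₂) c) :=
  have := h.isCardinalFiltered I
  have := isFiltered_of_isCardinalFiltered (DirectedSubset κ₁ κ₂ I) κ₂
  -- The map induced on `F i` does not depend on the directed subset containing `i`, because any two
  -- of them lie in a third. This makes the choices in `d` below harmless.
  have hs (s : Cocone (directedDiag (κ₁ := κ₁) (κ₂ := κ₂) F)) (i : I)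
      (B B' : DirectedSubset κ₁ κ₂ I) (hi : i ∈ B.1) (hi' : i ∈ B'.1) :
      subsetι F B i hi ≫ s.ι.app B = subsetι F B' i hi' ≫ s.ι.app B' := by
    rw [← subsetι_cocone_ι_eq s (leOfHom (IsFiltered.leftToMax B B')),
      ← subsetι_cocone_ι_eq s (leOfHom (IsFiltered.rightToMax B B'))]
  let d (s : Cocone (directedDiag (κ₁ := κ₁) (κ₂ := κ₂) F)) : Cocone F :=
    { pt := s.pt
      ι :=
        { app i := subsetι F (h.exists_mem i).choose i (h.exists_mem i).choose_spec ≫ s.ι.app _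
          naturality i j g := by
            let B : DirectedSubset κ₁ κ₂ I :=
              IsFiltered.max (h.exists_mem i).choose (h.exists_mem j).choose
            have h₁ : i ∈ B.1 := (show (h.exists_mem i).choose ≤ B from
              leOfHom (IsFiltered.leftToMax _ _)) (h.exists_mem i).choose_spec
            have h₂ : j ∈ B.1 := (show (h.exists_mem j).choose ≤ B from
              leOfHom (IsFiltered.rightToMax _ _)) (h.exists_mem j).choose_spec
            refine Eq.trans ?_ (comp_id _).symm
            refine Eq.trans ?_ (hs s i B _ h₁ (h.exists_mem i).choose_spec)
            refine (congrArg (fun k => F.map g ≫ k)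
              (hs s j _ B (h.exists_mem j).choose_spec h₂)).trans ?_
            refine (assoc _ _ _).symm.trans ?_
            exact congrArg (fun k => k ≫ s.ι.app B) (subsetι_w F B (leOfHom g) h₁ h₂) } }
  have hd (i : I) (s) (m : c.pt ⟶ s.pt) (B : DirectedSubset κ₁ κ₂ I) (hi : i ∈ B.1) :
      subsetι F B i hi ≫ subsetToPt c B ≫ m = c.ι.app i ≫ m := subsetι_desc_comp ..
  { desc s := hc.desc (d s)
    fac s B := subset_hom_ext F B (fun i hi =>
      ((hd i s _ B hi).trans (hc.fac (d s) i)).trans (hs s i _ _ _ _))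
    uniq s m hm := hc.hom_ext (fun i => by
      refine Eq.trans ?_ (hc.fac (d s) i).symm
      refine (hd i s m _ (h.exists_mem i).choose_spec).symm.trans ?_
      exact congrArg _ (hm _)) }

end

variable (C : Type u) [Category.{v} C]

/-- The objects which are `κ₁`-directed colimits of size `< κ₂` of `κ₁`-presentable objects. -/
def smallDirectedColimits (κ₁ κ₂ : Cardinal.{w}) [Fact κ₁.IsRegular] : ObjectProperty C := fun X =>
  ∃ (I : Type w) (_ : PartialOrder I) (_ : IsCardinalFiltered I κ₁) (_ : HasCardinalLT I κ₂),
    (isCardinalPresentable C κ₁).colimitsOfShape I X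

lemma hasCardinalLT_arrow_of_preorder {κ : Cardinal.{w}} [Fact κ.IsRegular] (I : Type w)
    [Preorder I] (hI : HasCardinalLT I κ) : HasCardinalLT (Arrow I) κ :=
  (hasCardinalLT_prod (IsRegular.aleph0_le Fact.out) hI hI).of_injective
    (fun f => (f.left, f.right)) (by
      rintro ⟨a, b, f⟩ ⟨a', b', f'⟩ h
      obtain ⟨rfl, rfl⟩ := Prod.ext_iff.1 h
      obtain rfl : f = f' := Subsingleton.elim _ _
      rfl)

variable [IsCardinalAccessibleCategory C κ₁] (h : IsSharplyLT κ₁ κ₂)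
include h

/-- A diagram with fewer than `κ₂` arrows of presentable objects has a `κ₂`-presentable colimit.
Conversely, a `κ₁`-directed presentation of any object is regrouped along its small directed subsets
by `isColimitDirectedCocone`. -/
lemma IsSharplyLT.isCardinalFilteredGenerator :
    (smallDirectedColimits C κ₁ κ₂).IsCardinalFilteredGenerator κ₂ where
  le_isCardinalPresentable := by
    rintro X ⟨I, _, _, hI, ⟨p⟩⟩
    exact p.isCardinalPresentable le_rfl κ₂ h.lt.le (hasCardinalLT_arrow_of_preorder I hI)
  exists_colimitsOfShape X := by
    obtain ⟨J, _, _, ⟨p⟩⟩ :=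
      (isCardinalFilteredGenerator_isCardinalPresentable C κ₁).exists_colimitsOfShape X
    obtain ⟨I, _, _, F, _⟩ := IsCardinalFiltered.exists_cardinal_directed J κ₁
    let q := p.reindex F
    have := h.isCardinalFiltered I
    refine ⟨DirectedSubset κ₁ κ₂ I, inferInstance, inferInstance, ⟨{
      diag := directedDiag q.diag
      ι := (directedCocone (κ₁ := κ₁) (κ₂ := κ₂) q.cocone).ι
      isColimit := isColimitDirectedCocone h q.isColimit
      prop_diag_obj B := ⟨B.1, inferInstance, inferInstance, B.2.2, ⟨{
        diag := restrictDiag q.diag B.1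
        ι := (colimit.cocone (restrictDiag q.diag B.1)).ι
        isColimit := colimit.isColimit _
        prop_diag_obj i := q.prop_diag_obj i.1 }⟩⟩ }⟩⟩

/-- A `κ₁`-accessible category is `κ₂`-accessible if `κ₁` is sharply smaller than `κ₂`. -/
lemma IsSharplyLT.isCardinalAccessibleCategory : IsCardinalAccessibleCategory C κ₂ := by
  -- Needed only for size: the closure of an essentially small class under colimits of size `< κ₂`
  -- is essentially small.
  have hle : smallDirectedColimits C κ₁ κ₂ ≤
      (isCardinalPresentable C κ₁).colimitsCardinalClosure κ₂ := by
    rintro X ⟨I, _, _, hI, hX⟩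
    have := ObjectProperty.isClosedUnderColimitsOfShape_colimitsCardinalClosure
      (isCardinalPresentable C κ₁) κ₂ I (hasCardinalLT_arrow_of_preorder I hI)
    exact ObjectProperty.colimitsOfShape_le _ I _
      (ObjectProperty.colimitsOfShape_monotone I
        (ObjectProperty.le_colimitsCardinalClosure _ κ₂) _ hX)
  have := ObjectProperty.EssentiallySmall.of_le.{w} hle
  have := (h.isCardinalFilteredGenerator C).hasCardinalFilteredGenerator
  exact
    { hasColimitsOfShape J _ _ := by
        have := IsCardinalFiltered.of_le J h.lt.le
        exact HasCardinalFilteredColimits.hasColimitsOfShape (κ := κ₁) C J }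

/-- A `κ₁`-accessible functor that sends `κ₁`-presentable objects to `κ₂`-presentable objects
preserves `κ₂`-presentable objects, if `κ₁` is sharply smaller than `κ₂`. -/
lemma IsSharplyLT.isCardinalPresentable_obj {D : Type u'} [Category.{v'} D] [LocallySmall.{w} D]
    (T : C ⥤ D) [T.IsCardinalAccessible κ₁]
    (hT : ∀ X, IsCardinalPresentable X κ₁ → IsCardinalPresentable (T.obj X) κ₂)
    (X : C) [hX : IsCardinalPresentable X κ₂] : IsCardinalPresentable (T.obj X) κ₂ := by
  -- A `κ₂`-presentable object is a retract of a small directed colimit of `κ₁`-presentable ones,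
  -- and `T` preserves both the colimit and the retraction.
  rw [← isCardinalPresentable_iff,
    (h.isCardinalFilteredGenerator C).isPresentable_eq_retractClosure] at hX
  obtain ⟨Y, ⟨I, _, _, hI, ⟨p⟩⟩, ⟨r⟩⟩ := hX
  have := T.preservesColimitsOfShape_of_isCardinalAccessible κ₁ I
  have (i : I) : IsCardinalPresentable ((p.map T).diag.obj i) κ₂ := hT _ (p.prop_diag_obj i)
  have : IsCardinalPresentable (T.obj Y) κ₂ :=
    isCardinalPresentable_of_isColimit _ (p.map T).isColimit κ₂
      (hasCardinalLT_arrow_of_preorder I hI)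
  exact (r.map T).isCardinalPresentable κ₂

end Raising

/-! ### Uniform indices of accessibility for small families of functors -/

section Uniformization

open Cardinal

/-- The index is raised along a sharp inequality; a merely larger regular cardinal would not do. -/
lemma exists_isCardinalAccessibleCategory (C : Type u) [Category.{v} C]
    [IsAccessibleCategory.{w} C] (ν : Cardinal.{w}) :
    ∃ (κ : Cardinal.{w}) (_ : Fact κ.IsRegular), ν < κ ∧ IsCardinalAccessibleCategory C κ := by
  obtain ⟨κ₁, _, _⟩ := IsAccessibleCategory.exists_cardinal.{w} C
  obtain ⟨κ₂, _, hν, h⟩ := exists_isSharplyLT κ₁ ν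
  exact ⟨κ₂, inferInstance, hν, h.isCardinalAccessibleCategory C⟩

/-- A small family of cardinals is bounded. -/
lemma exists_cardinal_bound {α : Type u} [Small.{w} α] (f : α → Cardinal.{w}) :
    ∃ ν : Cardinal.{w}, ∀ a, f a ≤ ν :=
  ⟨⨆ a, f a, fun a => le_ciSup (bddAbove_of_small) a⟩

/-- A small family of accessible functors is `κ`-accessible for all large `κ`. -/
lemma exists_forall_isCardinalAccessible {α : Type u} [Small.{w} α] {C : Type u₁} [Category.{v} C]
    {D : Type u₂} [Category.{v'} D] (T : α → C ⥤ D) (hT : ∀ a, (T a).IsAccessible.{w}) :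
    ∃ ν : Cardinal.{w}, ∀ (κ : Cardinal.{w}) [Fact κ.IsRegular], ν ≤ κ →
      ∀ a, (T a).IsCardinalAccessible κ := by
  choose f hf hf' using fun a => (hT a).exists_cardinal
  obtain ⟨ν, hν⟩ := exists_cardinal_bound f
  refine ⟨ν, fun κ _ h a => ?_⟩
  have := hf a
  have := hf' a
  exact (T a).isCardinalAccessible_of_le ((hν a).trans h)

/-- Uniformization: for a small family of accessible functors. -/
lemma exists_uniform {α : Type u'} [Small.{w} α] {C : Type u} [Category.{v} C]
    [IsAccessibleCategory.{w} C] (T : α → C ⥤ C) (hT : ∀ a, (T a).IsAccessible.{w}) :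
    ∃ (κ₁ κ₂ : Cardinal.{w}) (_ : Fact κ₁.IsRegular) (_ : Fact κ₂.IsRegular),
      κ₁ < κ₂ ∧ IsCardinalAccessibleCategory C κ₁ ∧ IsCardinalAccessibleCategory C κ₂ ∧
      ∀ a, (T a).IsCardinalAccessible κ₁ ∧
        ∀ X, IsCardinalPresentable X κ₂ → IsCardinalPresentable ((T a).obj X) κ₂ := by
  obtain ⟨ν, hν⟩ := exists_forall_isCardinalAccessible T hT
  obtain ⟨κ₁, _, hνκ₁, _⟩ := exists_isCardinalAccessibleCategory C ν
  -- Up to isomorphism there is only a small set of objects `T a X` with `X` a `κ₁`-presentable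
  -- object, so one cardinal bounds all their ranks; `κ₂` is taken beyond it and sharply above `κ₁`.
  obtain ⟨Q, _, hQ, hQ'⟩ := ObjectProperty.EssentiallySmall.exists_small_le.{w}
    (isCardinalPresentable C κ₁)
  have key (x : α × Subtype Q) : ∃ (κ : Cardinal.{w}), ∀ (κ' : Cardinal.{w}) [Fact κ'.IsRegular],
      κ ≤ κ' → IsCardinalPresentable ((T x.1).obj x.2.1) κ' := by
    obtain ⟨κ, _, _⟩ := (inferInstance : IsPresentable.{w} ((T x.1).obj x.2.1)).exists_cardinal
    have : IsCardinalPresentable ((T x.1).obj x.2.1) κ := ‹_›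
    exact ⟨κ, fun κ' _ h => isCardinalPresentable_of_le _ h⟩
  choose f hf using key
  obtain ⟨ν', hν'⟩ := exists_cardinal_bound f
  obtain ⟨κ₂, _, hκ₂, h⟩ := exists_isSharplyLT κ₁ ν'
  refine ⟨κ₁, κ₂, inferInstance, inferInstance, h.lt, inferInstance,
    h.isCardinalAccessibleCategory C, fun a => ?_⟩
  have := hν κ₁ hνκ₁.le a
  refine ⟨this, fun X hX => h.isCardinalPresentable_obj C (T a) (fun Y hY => ?_) X⟩
  obtain ⟨Z, hZ, ⟨e⟩⟩ := hQ' _ hY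
  have := hf ⟨a, Z, hZ⟩ κ₂ ((hν' _).trans hκ₂.le)
  exact isCardinalPresentable_of_iso ((T a).mapIso e.symm) κ₂

end Uniformization

/-! ### Hom objects and colimits in a tensored category -/

section TensorHom

variable {V : Type u'} [Category.{v'} V] [MonoidalCategory V] [MonoidalClosed V]
  {C : Type u} [Category.{v} C] [EnrichedOrdinaryCategory V C]

lemma Tensor.homEquiv_comp {M : V} {X : C} (T : Tensor V M X) {Y Z : C} (f : T.obj ⟶ Y)
    (g : Y ⟶ Z) : T.homEquiv Z (f ≫ g) = T.homEquiv Y f ≫ eHomWhiskerLeft V X g := by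
  rw [homEquiv_apply, homEquiv_apply, eHomWhiskerLeft_comp, assoc]

variable (t : Tensoring V C) (K : V)

/-- The bijection between maps `K ⊗ X ⟶ Y` and maps `K ⟶ [X, Y]`. -/
def Tensoring.homEquiv (X Y : C) : ((t.functor K).obj X ⟶ Y) ≃ (K ⟶ (X ⟶[V] Y)) :=
  (t.tensor K X).homEquiv Y

lemma Tensoring.homEquiv_comp {X Y Z : C} (f : (t.functor K).obj X ⟶ Y) (g : Y ⟶ Z) :
    t.homEquiv K X Z (f ≫ g) = t.homEquiv K X Y f ≫ eHomWhiskerLeft V X g :=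
  Tensor.homEquiv_comp _ _ _

lemma Tensoring.homEquiv_map_comp {X X' Y : C} (f : X ⟶ X') (g : (t.functor K).obj X' ⟶ Y) :
    t.homEquiv K X Y ((t.functor K).map f ≫ g) =
      t.homEquiv K X' Y g ≫ eHomWhiskerRight V f Y := by
  have h : t.homEquiv K X _ ((t.functor K).map f) =
      (t.tensor K X').unit ≫ eHomWhiskerRight V f _ := Equiv.apply_symm_apply _ _
  have h' : t.homEquiv K X' Y g = (t.tensor K X').unit ≫ eHomWhiskerLeft V X' g :=
    Tensor.homEquiv_apply _ _
  rw [homEquiv_comp, h, h']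
  refine (assoc _ _ _).trans (Eq.trans ?_ (assoc _ _ _).symm)
  exact congrArg (fun k => (t.tensor K X').unit ≫ k) (eHom_whisker_exchange V f g).symm

variable {J : Type u₁} [Category.{u₂} J] {Z : J ⥤ C} {c : Cocone Z}

variable {K} in
include t in
-- Under the tensor bijection, maps `K ⟶ [colim Z, Y]` are maps out of `K ⊗ colim Z = colim (K ⊗ Z
-- j)`. This is the uniqueness half of that universal property; `exists_desc` is the existence half.
lemma Tensoring.eHom_hom_ext [PreservesColimit Z (t.functor K)] (hc : IsColimit c) {Y : C}
    {β β' : K ⟶ (c.pt ⟶[V] Y)}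
    (h : ∀ j, β ≫ eHomWhiskerRight V (c.ι.app j) Y = β' ≫ eHomWhiskerRight V (c.ι.app j) Y) :
    β = β' := by
  obtain ⟨b, rfl⟩ := (t.homEquiv K _ _).surjective β
  obtain ⟨b', rfl⟩ := (t.homEquiv K _ _).surjective β'
  refine congrArg _ ((isColimitOfPreserves (t.functor K) hc).hom_ext (fun j => ?_))
  apply (t.homEquiv K _ _).injective
  exact (t.homEquiv_map_comp K (c.ι.app j) b).trans
    ((h j).trans (t.homEquiv_map_comp K (c.ι.app j) b').symm)

variable {K} in
include t in
lemma Tensoring.exists_desc [PreservesColimit Z (t.functor K)] (hc : IsColimit c) {Y : C}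
    (γ : ∀ j, K ⟶ (Z.obj j ⟶[V] Y))
    (hγ : ∀ ⦃j j'⦄ (f : j ⟶ j'), γ j' ≫ eHomWhiskerRight V (Z.map f) Y = γ j) :
    ∃ β : K ⟶ (c.pt ⟶[V] Y), ∀ j, β ≫ eHomWhiskerRight V (c.ι.app j) Y = γ j := by
  let s : Cocone (Z ⋙ t.functor K) :=
    { pt := Y
      ι :=
        { app j := (t.homEquiv K _ _).symm (γ j)
          naturality j j' f := by
            refine Eq.trans ?_ (comp_id _).symm
            apply (t.homEquiv K _ _).injective
            refine (t.homEquiv_map_comp K (Z.map f) ((t.homEquiv K _ _).symm (γ j'))).trans ?_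
            refine Eq.trans ?_ (Equiv.apply_symm_apply (t.homEquiv K _ Y) (γ j)).symm
            rw [Equiv.apply_symm_apply, hγ] } }
  refine ⟨t.homEquiv K _ _ ((isColimitOfPreserves (t.functor K) hc).desc s), fun j => ?_⟩
  rw [← homEquiv_map_comp]
  exact ((congrArg (t.homEquiv K _ _)
    ((isColimitOfPreserves (t.functor K) hc).fac s j))).trans (Equiv.apply_symm_apply _ _)

variable (κ : Cardinal.{w}) [Fact κ.IsRegular] [EssentiallySmall.{w} J] [IsCardinalFiltered J κ]

variable {K} in
include t in
-- Presentability of `K ⊗ X`, read through the tensor bijection; `exists_eq` is the matching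
-- statement on essential uniqueness.
lemma Tensoring.exists_lift {X : C} [IsCardinalPresentable ((t.functor K).obj X) κ]
    (hc : IsColimit c) (β : K ⟶ (X ⟶[V] c.pt)) :
    ∃ (j : J) (γ : K ⟶ (X ⟶[V] Z.obj j)), γ ≫ eHomWhiskerLeft V X (c.ι.app j) = β := by
  obtain ⟨b, rfl⟩ := (t.homEquiv K _ _).surjective β
  obtain ⟨j, g, hg⟩ := IsCardinalPresentable.exists_hom_of_isColimit κ hc b
  exact ⟨j, t.homEquiv K _ _ g, (t.homEquiv_comp K _ _).symm.trans (congrArg _ hg)⟩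

variable {K} in
include t in
lemma Tensoring.exists_eq {X : C} [IsCardinalPresentable ((t.functor K).obj X) κ]
    (hc : IsColimit c) {j : J} (γ γ' : K ⟶ (X ⟶[V] Z.obj j))
    (h : γ ≫ eHomWhiskerLeft V X (c.ι.app j) = γ' ≫ eHomWhiskerLeft V X (c.ι.app j)) :
    ∃ (j' : J) (f : j ⟶ j'),
      γ ≫ eHomWhiskerLeft V X (Z.map f) = γ' ≫ eHomWhiskerLeft V X (Z.map f) := by
  obtain ⟨g, rfl⟩ := (t.homEquiv K _ _).surjective γ
  obtain ⟨g', rfl⟩ := (t.homEquiv K _ _).surjective γ'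
  obtain ⟨j', f, hf⟩ := IsCardinalPresentable.exists_eq_of_isColimit' κ hc g g' (by
    apply (t.homEquiv K _ _).injective
    exact (t.homEquiv_comp K g (c.ι.app j)).trans (h.trans (t.homEquiv_comp K g' (c.ι.app j)).symm))
  exact ⟨j', f, by rw [← homEquiv_comp, ← homEquiv_comp, hf]⟩

end TensorHom

/-! ### Colimits of representations -/

section RepColimit

variable {V : Type u'} [Category.{v'} V] [MonoidalCategory V]
  {C : Type u} [Category.{v} C] [EnrichedOrdinaryCategory V C] {M : Mon V}

/-- A representation, given by a map of underlying objects that is compatible with the units and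
the multiplications. -/
def repMk (X : C) (α : M.X ⟶ (X ⟶[V] X)) (h₁ : MonObj.one ≫ α = eId V X)
    (h₂ : MonObj.mul ≫ α = (α ⊗ₘ α) ≫ eComp V X X X) : RepObj C M where
  X := X
  act := Mon.Hom.mk' (N := endMon V X) α h₁ h₂

lemma RepObj.one_act (A : RepObj C M) : MonObj.one ≫ A.act.hom = eId V A.X :=
  A.act.isMonHom_hom.one_hom

lemma RepObj.mul_act (A : RepObj C M) :
    MonObj.mul ≫ A.act.hom = (A.act.hom ⊗ₘ A.act.hom) ≫ eComp V A.X A.X A.X :=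
  A.act.isMonHom_hom.mul_hom

lemma comp_eComp_whiskerRight {K L : V} {X X' Y Y' : C} (f : X ⟶ X') (a : K ⟶ (X' ⟶[V] Y))
    (b : L ⟶ (Y ⟶[V] Y')) :
    ((a ⊗ₘ b) ≫ eComp V X' Y Y') ≫ eHomWhiskerRight V f Y' =
      ((a ≫ eHomWhiskerRight V f Y) ⊗ₘ b) ≫ eComp V X Y Y' := by
  rw [assoc, eComp_eHomWhiskerRight, ← tensorHom_id, tensorHom_comp_tensorHom_assoc, comp_id]

lemma comp_eComp_whiskerLeft {K L : V} {X Y Y' Z : C} (a : K ⟶ (X ⟶[V] Y))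
    (b : L ⟶ (Y ⟶[V] Y')) (f : Y' ⟶ Z) :
    ((a ⊗ₘ b) ≫ eComp V X Y Y') ≫ eHomWhiskerLeft V X f =
      (a ⊗ₘ (b ≫ eHomWhiskerLeft V Y f)) ≫ eComp V X Y Z := by
  rw [assoc, eComp_eHomWhiskerLeft, ← id_tensorHom, tensorHom_comp_tensorHom_assoc, comp_id]

lemma comp_eComp_middle {K L : V} {X Y Y' Z : C} (a : K ⟶ (X ⟶[V] Y)) (f : Y ⟶ Y')
    (b : L ⟶ (Y' ⟶[V] Z)) :
    ((a ≫ eHomWhiskerLeft V X f) ⊗ₘ b) ≫ eComp V X Y' Z =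
      (a ⊗ₘ (b ≫ eHomWhiskerRight V f Z)) ≫ eComp V X Y Z := by
  have h₁ : ((a ≫ eHomWhiskerLeft V X f) ⊗ₘ b) = (a ⊗ₘ b) ≫ eHomWhiskerLeft V X f ▷ _ := by
    rw [← tensorHom_id, tensorHom_comp_tensorHom, comp_id]
  have h₂ : (a ⊗ₘ (b ≫ eHomWhiskerRight V f Z)) = (a ⊗ₘ b) ≫ _ ◁ eHomWhiskerRight V f Z := by
    rw [← id_tensorHom, tensorHom_comp_tensorHom, comp_id]
  rw [h₁, h₂, assoc, assoc, eComp_middle]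

lemma eHomEquiv_whiskerLeft {X Y Z : C} (f : X ⟶ Y) (g : Y ⟶ Z) :
    eHomEquiv V f ≫ eHomWhiskerLeft V X g = eHomEquiv V (f ≫ g) := by
  rw [← eId_whiskerLeft, assoc, ← eHomWhiskerLeft_comp, eId_whiskerLeft]

lemma RepObj.one_act_whiskerLeft (A : RepObj C M) {T : C} (f : A.X ⟶ T) :
    MonObj.one ≫ A.act.hom ≫ eHomWhiskerLeft V A.X f = eHomEquiv V f := by
  rw [← assoc, one_act, eId_whiskerLeft]

/-- Dinaturality of composition moves `f` past the middle object, where `hβ` exchanges the action of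
`A` for `β`. This is the multiplicativity hypothesis `h₂` of `PreservesFor.exists_rep` for a diagram
of representations. -/
lemma RepObj.mul_act_whiskerLeft (A : RepObj C M) {T : C} (f : A.X ⟶ T)
    (β : M.X ⟶ (T ⟶[V] T))
    (hβ : β ≫ eHomWhiskerRight V f T = A.act.hom ≫ eHomWhiskerLeft V A.X f) :
    MonObj.mul ≫ A.act.hom ≫ eHomWhiskerLeft V A.X f =
      ((A.act.hom ≫ eHomWhiskerLeft V A.X f) ⊗ₘ β) ≫ eComp V A.X T T := by
  rw [← assoc, mul_act]
  refine (comp_eComp_whiskerLeft _ _ _).trans ?_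
  refine Eq.trans ?_ (comp_eComp_middle _ _ _).symm
  rw [hβ]

lemma act_whisker {A B : RepObj C M} (g : A ⟶ B) {T : C} (f : B.X ⟶ T) {h : A.X ⟶ T}
    (hf : g.f ≫ f = h) :
    (B.act.hom ≫ eHomWhiskerLeft V B.X f) ≫ eHomWhiskerRight V g.f T =
      A.act.hom ≫ eHomWhiskerLeft V A.X h := by
  subst hf
  rw [eHomWhiskerLeft_comp, ← assoc A.act.hom, g.comm, assoc, assoc, eHom_whisker_exchange]

/-- If `g` and `g ≫ f` are maps of representations, then `f` satisfies the condition to be one after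
restriction along `g`. -/
lemma act_whisker_comm {A B D : RepObj C M} (g : A ⟶ B) (f : B.X ⟶ D.X) (h : A ⟶ D)
    (hf : g.f ≫ f = h.f) :
    (B.act.hom ≫ eHomWhiskerLeft V B.X f) ≫ eHomWhiskerRight V g.f D.X =
      (D.act.hom ≫ eHomWhiskerRight V f D.X) ≫ eHomWhiskerRight V g.f D.X := by
  rw [act_whisker g f hf, assoc, ← eHomWhiskerRight_comp, hf, h.comm]

variable [MonoidalClosed V] (t : Tensoring V C)

/-- The functors `K ⊗ -` preserve the colimit of `Z`, for `K` one of `𝟙`, `M` and `M ⊗ M`. -/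
structure PreservesFor (M : Mon V) {J : Type u₁} [Category.{u₂} J] (Z : J ⥤ C) : Prop where
  one : PreservesColimit Z (t.functor (𝟙_ V))
  self : PreservesColimit Z (t.functor M.X)
  mul : PreservesColimit Z (t.functor (M.X ⊗ M.X))

variable {t} {J : Type u₁} [Category.{u₂} J] {Z : J ⥤ C} {c : Cocone Z}

/-- An action of `M` on the colimit of `Z` is given by a compatible family of maps
`M ⟶ [Z j, colim Z]` satisfying suitable equations. -/
lemma PreservesFor.exists_rep (ht : PreservesFor t M Z) (hc : IsColimit c)
    (γ : ∀ j, M.X ⟶ (Z.obj j ⟶[V] c.pt))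
    (hγ : ∀ ⦃j j'⦄ (f : j ⟶ j'), γ j' ≫ eHomWhiskerRight V (Z.map f) c.pt = γ j)
    (h₁ : ∀ j, MonObj.one ≫ γ j = eHomEquiv V (c.ι.app j))
    (h₂ : ∀ (β : M.X ⟶ (c.pt ⟶[V] c.pt)),
      (∀ j, β ≫ eHomWhiskerRight V (c.ι.app j) c.pt = γ j) →
      ∀ j, MonObj.mul ≫ γ j = (γ j ⊗ₘ β) ≫ eComp V (Z.obj j) c.pt c.pt) :
    ∃ (B : M ⟶ endMon V c.pt),
      ∀ j, B.hom ≫ eHomWhiskerRight V (c.ι.app j) c.pt = γ j := by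
  have := ht.one
  have := ht.self
  have := ht.mul
  obtain ⟨β, hβ⟩ := t.exists_desc hc γ hγ
  -- The unit law is an equation of maps out of `𝟙` and the multiplication law one of maps out of `M
  -- ⊗ M`. Both may be tested on each `Z j`, because these two functors also preserve the colimit.
  refine ⟨(repMk c.pt β (t.eHom_hom_ext hc (fun j => ?_))
    (t.eHom_hom_ext hc (fun j => ?_))).act, hβ⟩
  · rw [assoc, hβ, h₁]
    exact (eId_whiskerRight V (c.ι.app j)).symm
  · refine (assoc _ _ _).trans ?_
    refine Eq.trans ?_ (comp_eComp_whiskerRight _ _ _).symm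
    refine (congrArg (fun k => MonObj.mul ≫ k) (hβ j)).trans ((h₂ β hβ j).trans ?_)
    exact congrArg (fun k => (k ⊗ₘ β) ≫ eComp V (Z.obj j) c.pt c.pt) (hβ j).symm

variable {A : J ⥤ RepObj C M}

/-- The forgetful functor reflects the colimits that are preserved by `M ⊗ -`. -/
def isColimitOfForget [PreservesColimit (A ⋙ repForget C M) (t.functor M.X)] {c : Cocone A}
    (hc : IsColimit ((repForget C M).mapCocone c)) : IsColimit c :=
  have key (s : Cocone A) (j : J) :
      (c.ι.app j).f ≫ hc.desc ((repForget C M).mapCocone s) = (s.ι.app j).f :=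
    hc.fac ((repForget C M).mapCocone s) j
  { desc s :=
      { f := hc.desc ((repForget C M).mapCocone s)
        comm := t.eHom_hom_ext hc (fun j => by
          exact act_whisker_comm (c.ι.app j) _ (s.ι.app j) (key s j)) }
    fac s j := RepHom.ext (key s j)
    uniq s m hm := RepHom.ext (hc.hom_ext (fun j =>
      (congrArg RepHom.f (hm j)).trans (key s j).symm)) }

/-- The actions `M ⟶ [X j, X j]`, pushed forward to `[X j, colim X]`, form a compatible family and
so define an action on the colimit. It makes every leg equivariant, and the forgetful functor
reflects the resulting colimit. -/
lemma PreservesFor.exists_cocone (ht : PreservesFor t M (A ⋙ repForget C M))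
    {c : Cocone (A ⋙ repForget C M)} (hc : IsColimit c) :
    ∃ (c' : Cocone A), Nonempty (IsColimit c') ∧
      Nonempty (IsColimit ((repForget C M).mapCocone c')) := by
  have hw {j j' : J} (f : j ⟶ j') : (A.map f).f ≫ c.ι.app j' = c.ι.app j := c.w f
  obtain ⟨B, hB⟩ := ht.exists_rep hc
    (fun j => (A.obj j).act.hom ≫ eHomWhiskerLeft V (A.obj j).X (c.ι.app j))
    (fun j j' f => act_whisker (A.map f) (c.ι.app j') (hw f))
    (fun j => RepObj.one_act_whiskerLeft _ _)
    (fun β hβ j => RepObj.mul_act_whiskerLeft _ _ β (hβ j))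
  let c' : Cocone A :=
    { pt := ⟨c.pt, B⟩
      ι :=
        { app j := ⟨c.ι.app j, (hB j).symm⟩
          naturality j j' f := RepHom.ext (c.ι.naturality f) } }
  have hc' : IsColimit ((repForget C M).mapCocone c') := hc
  have := ht.self
  exact ⟨c', ⟨isColimitOfForget (t := t) hc'⟩, ⟨hc'⟩⟩

end RepColimit

/-! ### Long chains in directed posets -/

section Chain

/-- In a `κ₂`-directed poset there are chains of length `κ₁ < κ₂` that dominate the values of a given
function on their previous terms. -/
lemma exists_chain {κ₁ κ₂ : Cardinal.{w}} [Fact κ₁.IsRegular] [Fact κ₂.IsRegular] (hκ : κ₁ < κ₂)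
    {P : Type w} [PartialOrder P] [IsCardinalFiltered P κ₂] (R : P → P → P) (p₀ : P) :
    ∃ f : κ₁.ord.ToType → P, Monotone f ∧ (∀ i, p₀ ≤ f i) ∧
      ∀ i j k, i < k → j < k → R (f i) (f j) ≤ f k := by
  have h₀ : Cardinal.aleph0 ≤ κ₂ := Cardinal.IsRegular.aleph0_le Fact.out
  let α := κ₁.ord.ToType
  have hα (k : α) : HasCardinalLT (Set.Iio k) κ₂ :=
    HasCardinalLT.of_injective (X := α) (by
      rw [hasCardinalLT_iff_cardinal_mk_lt]; simpa [α] using hκ) _ Subtype.val_injective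
  -- Indexes what `f k` must dominate: the values of `R` on pairs of earlier terms, the earlier
  -- terms themselves (for monotonicity), and `p₀`. There are fewer than `κ₂` of these, so an upper
  -- bound exists and `f` is defined by well-founded recursion.
  let I (k : α) : Type w := (Set.Iio k × Set.Iio k) ⊕ (Set.Iio k ⊕ PUnit.{w + 1})
  have hI (k : α) : HasCardinalLT (I k) κ₂ := by
    rw [hasCardinalLT_sum_iff _ _ _ h₀, hasCardinalLT_sum_iff _ _ _ h₀]
    exact ⟨hasCardinalLT_prod h₀ (hα k) (hα k), hα k, hasCardinalLT_of_finite _ _ h₀⟩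
  let s (k : α) (g : ∀ i, i < k → P) : I k → P :=
    Sum.elim (fun x => R (g x.1.1 x.1.2) (g x.2.1 x.2.2))
      (Sum.elim (fun x => g x.1 x.2) (fun _ => p₀))
  let f : α → P := (wellFounded_lt (α := α)).fix
    (fun k g => IsCardinalFiltered.max (s k g) (hI k))
  have hf (k : α) : f k = IsCardinalFiltered.max (s k (fun i _ => f i)) (hI k) :=
    (wellFounded_lt (α := α)).fix_eq _ k
  have hle (k : α) (x : I k) : s k (fun i _ => f i) x ≤ f k := by
    rw [hf]
    exact leOfHom (IsCardinalFiltered.toMax (s k (fun i _ => f i)) (hI k) x)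
  refine ⟨f, fun i j hij => ?_, fun i => hle i (Sum.inr (Sum.inr ⟨⟩)), fun i j k hi hj =>
    hle k (Sum.inl ⟨⟨i, hi⟩, ⟨j, hj⟩⟩)⟩
  obtain rfl | hij := hij.eq_or_lt
  · exact le_rfl
  · exact hle j (Sum.inr (Sum.inl ⟨i, hij⟩))

variable {κ : Cardinal.{w}} [Fact κ.IsRegular]
  {C : Type u} [Category.{v} C] [HasCardinalFilteredColimits.{w} C κ]
  {P : Type w} [PartialOrder P] (Z : P ⥤ C) {f : κ.ord.ToType → P} (hf : Monotone f)

/-- The restriction of a diagram to a chain. -/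
abbrev chainDiag : κ.ord.ToType ⥤ C := hf.functor ⋙ Z

instance : HasColimit (chainDiag Z hf) :=
  have := HasCardinalFilteredColimits.hasColimitsOfShape (κ := κ) C κ.ord.ToType
  inferInstance

/-- The map from a term of the chain to its colimit. -/
def chainIn (k : κ.ord.ToType) : Z.obj (f k) ⟶ colimit (chainDiag Z hf) :=
  colimit.ι (chainDiag Z hf) k

lemma chainIn_w {k k' : κ.ord.ToType} (h : k ≤ k') :
    Z.map (homOfLE (hf h)) ≫ chainIn Z hf k' = chainIn Z hf k :=
  colimit.w (chainDiag Z hf) (homOfLE h)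

/-- The map from a term of the diagram, below a term of the chain, to the colimit of the chain. -/
def chainι (r : P) (hr : ∃ k, r ≤ f k) : Z.obj r ⟶ colimit (chainDiag Z hf) :=
  Z.map (homOfLE hr.choose_spec) ≫ chainIn Z hf hr.choose

/-- Independence of the chosen term above `r`: two terms of a chain are comparable, so both maps are
compared at the larger one. -/
lemma chainι_eq (r : P) (k : κ.ord.ToType) (hr : r ≤ f k) :
    chainι Z hf r ⟨k, hr⟩ = Z.map (homOfLE hr) ≫ chainIn Z hf k := by
  have h (k k' : κ.ord.ToType) (hr : r ≤ f k) (hkk' : k ≤ k') :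
      Z.map (homOfLE (hr.trans (hf hkk'))) ≫ chainIn Z hf k' =
        Z.map (homOfLE hr) ≫ chainIn Z hf k := by
    rw [← homOfLE_comp hr (hf hkk'), Z.map_comp, assoc, chainIn_w]
  let k' := (Exists.intro k hr : ∃ k, r ≤ f k).choose
  have hk' : r ≤ f k' := (Exists.intro k hr : ∃ k, r ≤ f k).choose_spec
  exact (h k' (max k k') hk' (le_max_right _ _)).symm.trans (h k (max k k') hr (le_max_left _ _))

lemma chainι_self (k : κ.ord.ToType) :
    chainι Z hf (f k) ⟨k, le_rfl⟩ = chainIn Z hf k := by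
  exact (chainι_eq Z hf (f k) k le_rfl).trans
    ((congrArg (fun g => g ≫ chainIn Z hf k) (Z.map_id (f k))).trans (id_comp _))

lemma chainι_w {r r' : P} (h : r ≤ r') (hr : ∃ k, r ≤ f k) (hr' : ∃ k, r' ≤ f k) :
    Z.map (homOfLE h) ≫ chainι Z hf r' hr' = chainι Z hf r hr := by
  obtain ⟨k, hk⟩ := hr'
  rw [chainι_eq Z hf r k (h.trans hk), chainι_eq Z hf r' k hk, ← assoc, ← Z.map_comp, homOfLE_comp]

lemma exists_chain_desc {T : C} (g : ∀ q, Z.obj q ⟶ T)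
    (hg : ∀ ⦃q q'⦄ (h : q ≤ q'), Z.map (homOfLE h) ≫ g q' = g q) :
    ∃ j : colimit (chainDiag Z hf) ⟶ T, ∀ r hr, chainι Z hf r hr ≫ j = g r := by
  let s : Cocone (chainDiag Z hf) :=
    { pt := T
      ι := { app i := g (f i)
             naturality i i' h := (hg (hf (leOfHom h))).trans (comp_id _).symm } }
  have hs (k) : chainIn Z hf k ≫ colimit.desc (chainDiag Z hf) s = g (f k) := colimit.ι_desc s k
  refine ⟨colimit.desc (chainDiag Z hf) s, ?_⟩
  rintro r ⟨k, hr⟩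
  rw [chainι_eq Z hf r k hr, assoc, hs, hg]

/-- A chain of length `κ < κ'` has fewer than `κ'` arrows. In the approximation argument the chain
is thus long enough for tensors to preserve its colimit and short enough to keep presentability. -/
lemma isCardinalPresentable_chain [LocallySmall.{w} C] {κ' : Cardinal.{w}} [Fact κ'.IsRegular]
    (h : κ < κ') (hZ : ∀ q, IsCardinalPresentable (Z.obj q) κ') :
    IsCardinalPresentable (colimit (chainDiag Z hf)) κ' := by
  have (k : κ.ord.ToType) : IsCardinalPresentable ((chainDiag Z hf).obj k) κ' := hZ _
  exact isCardinalPresentable_of_isColimit _ (colimit.isColimit (chainDiag Z hf)) κ'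
    (hasCardinalLT_arrow_of_preorder _ (by
      rw [hasCardinalLT_iff_cardinal_mk_lt]; simpa using h))

end Chain

/-! ### Approximation of representations by presentable representations -/

section Approx

variable {V : Type u'} [Category.{v'} V] [MonoidalCategory V] [MonoidalClosed V]
  {C : Type u} [Category.{v} C] [EnrichedOrdinaryCategory V C]

/-- The functor `K ⊗ -` is `κ₁`-accessible and preserves `κ₂`-presentable objects. -/
structure IsUniform (t : Tensoring V C) (κ₁ κ₂ : Cardinal.{w}) [Fact κ₁.IsRegular]
    [Fact κ₂.IsRegular] (K : V) : Prop where
  acc : (t.functor K).IsCardinalAccessible κ₁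
  pres (X : C) (hX : IsCardinalPresentable X κ₂) : IsCardinalPresentable ((t.functor K).obj X) κ₂

/-- The functors `K ⊗ -` are uniform, for `K` one of `𝟙`, `M` and `M ⊗ M`. -/
structure IsUniformFor (t : Tensoring V C) (κ₁ κ₂ : Cardinal.{w}) [Fact κ₁.IsRegular]
    [Fact κ₂.IsRegular] (M : Mon V) : Prop where
  one : IsUniform t κ₁ κ₂ (𝟙_ V)
  self : IsUniform t κ₁ κ₂ M.X
  mul : IsUniform t κ₁ κ₂ (M.X ⊗ M.X)

variable {t : Tensoring V C} {κ₁ κ₂ : Cardinal.{w}} [Fact κ₁.IsRegular] [Fact κ₂.IsRegular]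
  {M : Mon V}

lemma IsUniformFor.preservesFor (ht : IsUniformFor t κ₁ κ₂ M) {J : Type w} [SmallCategory J]
    [IsCardinalFiltered J κ₁] (Z : J ⥤ C) : PreservesFor t M Z := by
  have := ht.one.acc
  have := ht.self.acc
  have := ht.mul.acc
  have := (t.functor (𝟙_ V)).preservesColimitsOfShape_of_isCardinalAccessible κ₁ J
  have := (t.functor M.X).preservesColimitsOfShape_of_isCardinalAccessible κ₁ J
  have := (t.functor (M.X ⊗ M.X)).preservesColimitsOfShape_of_isCardinalAccessible κ₁ J
  exact ⟨inferInstance, inferInstance, inferInstance⟩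

variable {P : Type w} [PartialOrder P] {X : C}
  (p : (isCardinalPresentable C κ₂).ColimitOfShape P X)

/-- The structural maps of a presentation of an object as a directed colimit. -/
def approxι (q : P) : p.diag.obj q ⟶ X := p.ι.app q

lemma approxι_w {q q' : P} (h : q ≤ q') :
    p.diag.map (homOfLE h) ≫ approxι p q' = approxι p q :=
  p.w (homOfLE h)

variable [IsCardinalFiltered P κ₂]

lemma IsUniform.exists_lift {K : V} (hK : IsUniform t κ₁ κ₂ K) {Y : C}
    (hY : IsCardinalPresentable Y κ₂) (β : K ⟶ (Y ⟶[V] X)) :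
    ∃ (q : P) (γ : K ⟶ (Y ⟶[V] p.diag.obj q)), γ ≫ eHomWhiskerLeft V Y (approxι p q) = β := by
  have := hK.pres Y hY
  exact t.exists_lift κ₂ p.isColimit β

/-- Both maps are first moved to a common upper bound of `q` and `q'`; essential uniqueness of
factorizations through a filtered colimit then applies. -/
lemma IsUniform.exists_eq {K : V} (hK : IsUniform t κ₁ κ₂ K) {Y : C}
    (hY : IsCardinalPresentable Y κ₂) {q q' : P} (γ : K ⟶ (Y ⟶[V] p.diag.obj q))
    (γ' : K ⟶ (Y ⟶[V] p.diag.obj q'))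
    (h : γ ≫ eHomWhiskerLeft V Y (approxι p q) = γ' ≫ eHomWhiskerLeft V Y (approxι p q')) :
    ∃ (r : P) (hq : q ≤ r) (hq' : q' ≤ r),
      γ ≫ eHomWhiskerLeft V Y (p.diag.map (homOfLE hq)) =
        γ' ≫ eHomWhiskerLeft V Y (p.diag.map (homOfLE hq')) := by
  have := hK.pres Y hY
  have := isFiltered_of_isCardinalFiltered P κ₂
  obtain ⟨r, hq, hq'⟩ : ∃ r, q ≤ r ∧ q' ≤ r :=
    ⟨_, leOfHom (IsFiltered.leftToMax q q'), leOfHom (IsFiltered.rightToMax q q')⟩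
  obtain ⟨r', f, hr'⟩ := t.exists_eq (K := K) κ₂ p.isColimit
    (γ ≫ eHomWhiskerLeft V Y (p.diag.map (homOfLE hq)))
    (γ' ≫ eHomWhiskerLeft V Y (p.diag.map (homOfLE hq'))) (by
      refine (assoc _ _ _).trans (Eq.trans ?_ (assoc _ _ _).symm)
      refine (congrArg (fun k => γ ≫ k) (eHomWhiskerLeft_comp V _ _ _).symm).trans
        (Eq.trans ?_ (congrArg (fun k => γ' ≫ k) (eHomWhiskerLeft_comp V _ _ _)))
      refine (congrArg (fun k => γ ≫ eHomWhiskerLeft V Y k) (approxι_w p hq)).trans (h.trans ?_)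
      exact (congrArg (fun k => γ' ≫ eHomWhiskerLeft V Y k) (approxι_w p hq')).symm)
  refine ⟨r', hq.trans (leOfHom f), hq'.trans (leOfHom f), ?_⟩
  rw [← homOfLE_comp hq (leOfHom f), ← homOfLE_comp hq' (leOfHom f), Functor.map_comp,
    Functor.map_comp, eHomWhiskerLeft_comp, eHomWhiskerLeft_comp, ← assoc, ← assoc]
  exact hr'

end Approx

/-! ### The key lemma: presentable representations over a given one -/

section KeyLemma

variable {V : Type u'} [Category.{v'} V] [MonoidalCategory V] [MonoidalClosed V]
  {C : Type u} [Category.{v} C] [EnrichedOrdinaryCategory V C]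
  {t : Tensoring V C} {κ₁ κ₂ : Cardinal.{w}} [Fact κ₁.IsRegular] [Fact κ₂.IsRegular]
  {M : Mon V}
  {P : Type w} [PartialOrder P] [IsCardinalFiltered P κ₂]

/-- The action of `A` restricted to a stage `q` lifts to `b q : M ⟶ [Z q, Z (φ q)]`, which satisfies
the axioms of an action only after passing to later stages. Along a chain of length `κ₁` closed
under these passages the lifts glue to an action on the colimit `B`. The extra family `As` is what
later yields filteredness: all the given maps to `A` factor through `B` equivariantly at once. -/
lemma exists_rep_of_family [HasCardinalFilteredColimits.{w} C κ₁] [LocallySmall.{w} C]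
    (hκ : κ₁ < κ₂) (ht : IsUniformFor t κ₁ κ₂ M)
    (A : RepObj C M) (p : (isCardinalPresentable C κ₂).ColimitOfShape P A.X) (p₀ : P)
    {S : Type w} (hS : HasCardinalLT S κ₂) (As : S → RepObj C M)
    (hAs : ∀ s, IsCardinalPresentable (As s).X κ₂) (f : ∀ s, As s ⟶ A)
    (x : ∀ s, (As s).X ⟶ p.diag.obj p₀) (hx : ∀ s, x s ≫ approxι p p₀ = (f s).f) :
    ∃ (B : RepObj C M) (_ : IsCardinalPresentable B.X κ₂) (g : B ⟶ A)
      (y : p.diag.obj p₀ ⟶ B.X), y ≫ g.f = approxι p p₀ ∧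
        ∀ s, (As s).act.hom ≫ eHomWhiskerLeft V (As s).X (x s ≫ y) =
          B.act.hom ≫ eHomWhiskerRight V (x s ≫ y) B.X := by
  have hZ (q : P) : IsCardinalPresentable (p.diag.obj q) κ₂ := p.prop_diag_obj q
  -- local lifts of the action
  choose φ b hb using fun q => ht.self.exists_lift p (hZ q)
    (A.act.hom ≫ eHomWhiskerRight V (approxι p q) A.X)
  have hb' (q : P) : b q ≫ eHomWhiskerLeft V (p.diag.obj q) (approxι p (φ q)) =
    A.act.hom ≫ eHomWhiskerRight V (approxι p q) A.X := hb q
  -- Four identities that hold in `A`, hence at some later stage: compatibility of the lifts at `q ≤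
  -- q'` (`e₁`), unit (`e₂`), multiplication, with `b q` followed by `b (φ q)` (`e₃`), and
  -- equivariance of the maps from the `As s` (`e₄`).
  have e₁ (q q' : P) (h : q ≤ q') := ht.self.exists_eq p (hZ q) (b q)
    (b q' ≫ eHomWhiskerRight V (p.diag.map (homOfLE h)) (p.diag.obj (φ q'))) (by
      rw [hb', assoc, ← eHom_whisker_exchange, ← assoc, hb', assoc, ← eHomWhiskerRight_comp,
        approxι_w])
  choose r₁ hr₁ hr₁' hr₁'' using e₁
  have e₂ (q : P) := ht.one.exists_eq p (hZ q) (MonObj.one ≫ b q) (eId V (p.diag.obj q)) (by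
    rw [assoc, hb', ← assoc, RepObj.one_act, eId_whiskerLeft, eId_whiskerRight])
  choose r₂ hr₂ hr₂' hr₂'' using e₂
  have e₃ (q : P) := ht.mul.exists_eq p (hZ q) (MonObj.mul ≫ b q)
    ((b q ⊗ₘ b (φ q)) ≫ eComp V _ _ _) (by
      rw [assoc, hb', ← assoc, RepObj.mul_act, comp_eComp_whiskerRight, comp_eComp_whiskerLeft,
        hb', ← comp_eComp_middle, hb'])
  choose r₃ hr₃ hr₃' hr₃'' using e₃
  have e₄ (q : P) (h : p₀ ≤ q) (s : S) := ht.self.exists_eq p (hAs s)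
    ((As s).act.hom ≫ eHomWhiskerLeft V (As s).X (x s ≫ p.diag.map (homOfLE h)))
    (b q ≫ eHomWhiskerRight V (x s ≫ p.diag.map (homOfLE h)) (p.diag.obj (φ q))) (by
      rw [assoc, assoc, ← eHomWhiskerLeft_comp, assoc, approxι_w, hx, (f s).comm,
        ← eHom_whisker_exchange, ← assoc, hb', assoc, ← eHomWhiskerRight_comp, assoc,
        approxι_w, hx])
  choose r₄ hr₄ hr₄' hr₄'' using e₄
  -- a common bound
  have hR (q q' : P) : ∃ r, φ q ≤ r ∧ φ (φ q) ≤ r ∧ (∀ h : q ≤ q', r₁ q q' h ≤ r) ∧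
      (∀ h : φ q ≤ q', r₁ (φ q) q' h ≤ r) ∧ r₂ q ≤ r ∧ r₃ q ≤ r ∧
      ∀ h s, r₄ q h s ≤ r := by
    classical
    have h₀ : Cardinal.aleph0 ≤ κ₂ := Cardinal.IsRegular.aleph0_le Fact.out
    -- The default value `q` stands where a stage is defined only under an inequality; the
    -- corresponding bound is claimed only when that inequality holds.
    let k : Fin 6 ⊕ S → P := Sum.elim ![φ q, φ (φ q), if h : q ≤ q' then r₁ q q' h else q,
      if h : φ q ≤ q' then r₁ (φ q) q' h else q, r₂ q, r₃ q]
      (fun s => if h : p₀ ≤ q then r₄ q h s else q)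
    have hk : HasCardinalLT (Fin 6 ⊕ S) κ₂ :=
      (hasCardinalLT_sum_iff _ _ _ h₀).2 ⟨hasCardinalLT_of_finite _ _ h₀, hS⟩
    have hle (a) : k a ≤ IsCardinalFiltered.max k hk :=
      leOfHom (IsCardinalFiltered.toMax k hk a)
    refine ⟨IsCardinalFiltered.max k hk, hle (Sum.inl 0), hle (Sum.inl 1), fun h => ?_, fun h => ?_,
      hle (Sum.inl 4), hle (Sum.inl 5), fun h s => ?_⟩
    · simpa [k, h] using hle (Sum.inl 2)
    · simpa [k, h] using hle (Sum.inl 3)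
    · simpa [k, h] using hle (Sum.inr s)
  choose R hR₁ hR₂ hR₃ hR₄ hR₅ hR₆ hR₇ using hR
  obtain ⟨l, hl, hl₀, hlR⟩ := exists_chain hκ R p₀
  have : NoMaxOrder κ₁.ord.ToType := Cardinal.noMaxOrder (Cardinal.IsRegular.aleph0_le Fact.out)
  have : Nonempty κ₁.ord.ToType :=
    Cardinal.nonempty_ord_toType (c := κ₁) (Cardinal.IsRegular.ne_zero Fact.out)
  -- The chain dominates `R` only at strictly later indices, and these exist because `κ₁.ord` has no
  -- largest element.
  have hRl (i j : κ₁.ord.ToType) {r : P} (h : r ≤ R (l i) (l j)) : ∃ k, r ≤ l k := by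
    obtain ⟨k, hk⟩ := exists_gt (max i j)
    exact ⟨k, h.trans (hlR i j k ((le_max_left _ _).trans_lt hk) ((le_max_right _ _).trans_lt hk))⟩
  -- transport of equations to the colimit of the chain
  have tr {K : V} {Y : C} {q q' r : P} (hq : q ≤ r) (hq' : q' ≤ r) (hr : ∃ k, r ≤ l k)
      {γ : K ⟶ (Y ⟶[V] p.diag.obj q)} {γ' : K ⟶ (Y ⟶[V] p.diag.obj q')}
      (h : γ ≫ eHomWhiskerLeft V Y (p.diag.map (homOfLE hq)) =
        γ' ≫ eHomWhiskerLeft V Y (p.diag.map (homOfLE hq'))) (hk : ∃ k, q ≤ l k)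
      (hk' : ∃ k, q' ≤ l k) :
      γ ≫ eHomWhiskerLeft V Y (chainι p.diag hl q hk) =
        γ' ≫ eHomWhiskerLeft V Y (chainι p.diag hl q' hk') := by
    rw [← chainι_w p.diag hl hq hk hr, ← chainι_w p.diag hl hq' hk' hr, eHomWhiskerLeft_comp,
      eHomWhiskerLeft_comp, ← assoc, h, assoc]
  have hφ (i) : ∃ k, φ (l i) ≤ l k := hRl i i (hR₁ _ _)
  have hφφ (i) : ∃ k, φ (φ (l i)) ≤ l k := hRl i i (hR₂ _ _)
  let γ (i) : M.X ⟶ (p.diag.obj (l i) ⟶[V] colimit (chainDiag p.diag hl)) :=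
    b (l i) ≫ eHomWhiskerLeft V _ (chainι p.diag hl (φ (l i)) (hφ i))
  have hγ (i j) (h : i ≤ j) :
      γ j ≫ eHomWhiskerRight V (p.diag.map (homOfLE (hl h))) _ = γ i := by
    have := tr _ _ (hRl i j (hR₃ _ _ (hl h))) (hr₁'' _ _ (hl h)) (hφ i) (hφ j)
    rw [assoc, ← eHom_whisker_exchange, ← assoc] at this
    exact this.symm
  -- The stage `φ (l i)` need not belong to the chain, yet the multiplication law involves `b (φ (l
  -- i))`. Comparing it with a chain term above is the purpose of the bound on `r₁ (φ q) q'` in `R`.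
  have hγ' (i j) (h : φ (l i) ≤ l j) :
      γ j ≫ eHomWhiskerRight V (p.diag.map (homOfLE h)) _ =
        b (φ (l i)) ≫ eHomWhiskerLeft V _ (chainι p.diag hl (φ (φ (l i))) (hφφ i)) := by
    have := tr _ _ (hRl i j (hR₄ _ _ h)) (hr₁'' _ _ h) (hφφ i) (hφ j)
    rw [assoc, ← eHom_whisker_exchange, ← assoc] at this
    exact this.symm
  have hmul (β : M.X ⟶ (colimit (chainDiag p.diag hl) ⟶[V] colimit (chainDiag p.diag hl)))
      (hβ : ∀ j, β ≫ eHomWhiskerRight V (chainIn p.diag hl j) _ = γ j) (i) :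
      MonObj.mul ≫ γ i = (γ i ⊗ₘ β) ≫ eComp V (p.diag.obj (l i)) _ _ := by
    have h₁ := tr _ _ (hRl i i (hR₆ _ _)) (hr₃'' _) (hφ i) (hφφ i)
    obtain ⟨j, hj⟩ := hφ i
    rw [comp_eComp_whiskerLeft, ← hγ' i j hj, ← hβ, assoc, assoc, ← eHomWhiskerRight_comp,
      ← chainι_eq, ← comp_eComp_middle] at h₁
    exact h₁
  obtain ⟨β, hβ⟩ := (ht.preservesFor (chainDiag p.diag hl)).exists_rep
    (colimit.isColimit (chainDiag p.diag hl)) γ (fun i j h => hγ i j (leOfHom h))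
    (fun i => by
      have h₁ := tr _ _ (hRl i i (hR₅ _ _)) (hr₂'' _) (hφ i) ⟨i, le_rfl⟩
      rw [eId_whiskerLeft, assoc, chainι_self] at h₁
      exact h₁)
    hmul
  have hβ' (j) : β.hom ≫ eHomWhiskerRight V (chainIn p.diag hl j) _ = γ j := hβ j
  obtain ⟨g, hg⟩ := exists_chain_desc p.diag hl (approxι p) (fun _ _ h => approxι_w p h)
  have h₀ : ∃ k, p₀ ≤ l k := ⟨Classical.arbitrary _, hl₀ _⟩
  have hP := ht.self.acc
  have := (t.functor M.X).preservesColimitsOfShape_of_isCardinalAccessible κ₁ κ₁.ord.ToType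
  refine ⟨⟨_, β⟩, isCardinalPresentable_chain p.diag hl hκ hZ, ⟨g, ?_⟩, chainι p.diag hl p₀ h₀,
    hg _ _, fun s => ?_⟩
  -- Equivariance of `B ⟶ A` is tested on each term of the chain, where it says that `b` lifts the
  -- action of `A`.
  · refine t.eHom_hom_ext (colimit.isColimit (chainDiag p.diag hl)) (fun i => ?_)
    change (β.hom ≫ eHomWhiskerLeft V _ g) ≫ eHomWhiskerRight V (chainIn p.diag hl i) _ =
      (A.act.hom ≫ eHomWhiskerRight V g A.X) ≫ eHomWhiskerRight V (chainIn p.diag hl i) _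
    have hgi : chainIn p.diag hl i ≫ g = approxι p (l i) := by
      rw [← chainι_self, hg]
    rw [assoc, assoc, eHom_whisker_exchange, ← assoc, hβ', ← eHomWhiskerRight_comp, hgi, ← hb',
      assoc, ← eHomWhiskerLeft_comp, hg]
  · let i := Classical.arbitrary κ₁.ord.ToType
    have h₁ := tr _ _ (hRl i i (hR₇ _ _ (hl₀ i) s)) (hr₄'' _ (hl₀ i) s) ⟨i, le_rfl⟩ (hφ i)
    rw [assoc, assoc, ← eHomWhiskerLeft_comp, ← eHom_whisker_exchange, ← assoc (b (l i))] at h₁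
    have h₂ : x s ≫ chainι p.diag hl p₀ h₀ =
        (x s ≫ p.diag.map (homOfLE (hl₀ i))) ≫ chainIn p.diag hl i := by
      rw [chainι_eq p.diag hl p₀ i (hl₀ i), assoc]
    rw [h₂, eHomWhiskerRight_comp, ← assoc β.hom, hβ', ← chainι_self, assoc]
    rw [assoc] at h₁
    exact h₁

end KeyLemma

/-! ### Accessibility of categories of representations -/

section Presentable

variable {C : Type u} [Category.{v} C] {κ : Cardinal.{w}} [Fact κ.IsRegular]
  {P : Type w} [PartialOrder P] [IsCardinalFiltered P κ] {X : C}
  (p : (isCardinalPresentable C κ).ColimitOfShape P X)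

lemma exists_approx {S : Type w} (hS : HasCardinalLT S κ) (Z : S → C)
    (hZ : ∀ s, IsCardinalPresentable (Z s) κ) (f : ∀ s, Z s ⟶ X) :
    ∃ (q : P) (x : ∀ s, Z s ⟶ p.diag.obj q), ∀ s, x s ≫ approxι p q = f s := by
  choose q x hx using fun s => IsCardinalPresentable.exists_hom_of_isColimit κ p.isColimit (f s)
  refine ⟨IsCardinalFiltered.max q hS,
    fun s => x s ≫ p.diag.map (homOfLE (leOfHom (IsCardinalFiltered.toMax q hS s))), fun s => ?_⟩
  rw [assoc, approxι_w]
  exact hx s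

/-- Each pair agrees at some stage after `q`; a wide span of fewer than `κ` arrows out of `q` can be
completed in a `κ`-filtered category, giving one arrow for all pairs. -/
lemma exists_approx_eq {S : Type w} (hS : HasCardinalLT S κ) (Z : S → C)
    (hZ : ∀ s, IsCardinalPresentable (Z s) κ) (q : P) (a b : ∀ s, Z s ⟶ p.diag.obj q)
    (h : ∀ s, a s ≫ approxι p q = b s ≫ approxι p q) :
    ∃ (r : P) (f : q ⟶ r), ∀ s, a s ≫ p.diag.map f = b s ≫ p.diag.map f := by
  choose r f hf using
    fun s => IsCardinalPresentable.exists_eq_of_isColimit' κ p.isColimit (a s) (b s) (h s)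
  obtain ⟨k, _, g, hg⟩ := IsCardinalFiltered.wideSpan f hS
  exact ⟨k, g, fun s => by rw [← hg s, p.diag.map_comp, ← assoc, hf, assoc]⟩

variable (κ X) in
lemma exists_directed_presentation [IsCardinalAccessibleCategory C κ] :
    ∃ (P : Type w) (_ : PartialOrder P) (_ : IsCardinalFiltered P κ),
      Nonempty ((isCardinalPresentable C κ).ColimitOfShape P X) := by
  obtain ⟨J, _, _, ⟨p⟩⟩ :=
    (isCardinalFilteredGenerator_isCardinalPresentable C κ).exists_colimitsOfShape X
  obtain ⟨P, _, _, F, _⟩ := IsCardinalFiltered.exists_cardinal_directed J κ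
  exact ⟨P, inferInstance, inferInstance, ⟨p.reindex F⟩⟩

end Presentable

/-! ### Presentable representations generate, and `Rep M` is accessible -/

section RepAccessible

variable {V : Type u'} [Category.{v'} V] [MonoidalCategory V] [MonoidalClosed V]
  {C : Type u} [Category.{v} C] [EnrichedOrdinaryCategory V C]
  {t : Tensoring V C} {κ₁ κ₂ : Cardinal.{w}} [Fact κ₁.IsRegular] [Fact κ₂.IsRegular]
  {M : Mon V}

variable (C κ₂ M) in
/-- The representations on `κ₂`-presentable objects. -/
def presentableReps : ObjectProperty (RepObj C M) := fun A => IsCardinalPresentable A.X κ₂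

/-- An object of the category of presentable representations over `A`. -/
abbrev presentableOver {A B : RepObj C M} (hB : presentableReps C κ₂ M B) (g : B ⟶ A) :
    CostructuredArrow (presentableReps C κ₂ M).ι A :=
  CostructuredArrow.mk (S := (presentableReps C κ₂ M).ι)
    (Y := (⟨B, hB⟩ : (presentableReps C κ₂ M).FullSubcategory)) g

/-- A map in the category of presentable representations over `A`. -/
abbrev presentableOverMap {A B : RepObj C M} (hB : presentableReps C κ₂ M B) (g : B ⟶ A)
    (k : CostructuredArrow (presentableReps C κ₂ M).ι A) (y : k.left.obj ⟶ B)
    (hy : y ≫ g = k.hom) : k ⟶ presentableOver hB g :=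
  CostructuredArrow.homMk (ObjectProperty.homMk y) hy

section

variable [HasCardinalFilteredColimits.{w} C κ₁] [IsCardinalAccessibleCategory C κ₂]
    (hκ : κ₁ < κ₂) (ht : IsUniformFor t κ₁ κ₂ M) {A : RepObj C M}

include hκ ht

/-- The key lemma with an empty family, started at a stage through which `z` factors. -/
lemma exists_presentableRep_of_hom {Z : C} (hZ : IsCardinalPresentable Z κ₂) (z : Z ⟶ A.X) :
    ∃ (B : RepObj C M) (_ : presentableReps C κ₂ M B) (g : B ⟶ A) (y : Z ⟶ B.X),
      y ≫ g.f = z := by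
  obtain ⟨P, _, _, ⟨p⟩⟩ := exists_directed_presentation κ₂ A.X
  obtain ⟨q, x, hx⟩ := IsCardinalPresentable.exists_hom_of_isColimit κ₂ p.isColimit z
  obtain ⟨B, hB, g, y, hy, -⟩ := exists_rep_of_family hκ ht A p q
    (hasCardinalLT_of_finite PEmpty.{w + 1} κ₂ (Cardinal.IsRegular.aleph0_le Fact.out))
    (fun s => s.elim) (fun s => s.elim) (fun s => s.elim) (fun s => s.elim) (fun s => s.elim)
  exact ⟨B, hB, g, x ≫ y, by rw [assoc, hy]; exact hx⟩

lemma exists_presentableRep_of_family {S : Type w} (hS : HasCardinalLT S κ₂) (As : S → RepObj C M)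
    (hAs : ∀ s, presentableReps C κ₂ M (As s)) (f : ∀ s, As s ⟶ A) :
    ∃ (B : RepObj C M) (_ : presentableReps C κ₂ M B) (g : B ⟶ A) (y : ∀ s, As s ⟶ B),
      ∀ s, y s ≫ g = f s := by
  obtain ⟨P, _, _, ⟨p⟩⟩ := exists_directed_presentation κ₂ A.X
  obtain ⟨q, x, hx⟩ := exists_approx p hS (fun s => (As s).X) hAs (fun s => (f s).f)
  obtain ⟨B, hB, g, y, hy, hy'⟩ := exists_rep_of_family hκ ht A p q hS As hAs f x hx
  exact ⟨B, hB, g, fun s => ⟨x s ≫ y, hy' s⟩, fun s => RepHom.ext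
    ((assoc _ _ _).trans ((congrArg (fun k => x s ≫ k) hy).trans (hx s)))⟩

/-- The map `f` factors through a stage of `A.X`, and at a later stage the given pairs already
agree. The key lemma for the single representation `A'` is started there. -/
lemma exists_presentableRep_of_eq {S : Type w} (hS : HasCardinalLT S κ₂) (A' : RepObj C M)
    (hA' : presentableReps C κ₂ M A') (f : A' ⟶ A) (Z : S → C)
    (hZ : ∀ s, IsCardinalPresentable (Z s) κ₂) (a b : ∀ s, Z s ⟶ A'.X)
    (h : ∀ s, a s ≫ f.f = b s ≫ f.f) :
    ∃ (B : RepObj C M) (_ : presentableReps C κ₂ M B) (g : B ⟶ A) (y : A' ⟶ B),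
      y ≫ g = f ∧ ∀ s, a s ≫ y.f = b s ≫ y.f := by
  obtain ⟨P, _, _, ⟨p⟩⟩ := exists_directed_presentation κ₂ A.X
  have hA'' : IsCardinalPresentable A'.X κ₂ := hA'
  obtain ⟨q, x, hx⟩ := IsCardinalPresentable.exists_hom_of_isColimit κ₂ p.isColimit f.f
  have hx' : x ≫ approxι p q = f.f := hx
  obtain ⟨r, k, hk⟩ := exists_approx_eq p hS Z hZ q (fun s => a s ≫ x) (fun s => b s ≫ x)
    (fun s => by rw [assoc, assoc, hx', h])
  have hx'' : (x ≫ p.diag.map k) ≫ approxι p r = f.f := by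
    rw [assoc]
    exact (congrArg (fun k => x ≫ k) (approxι_w p (leOfHom k))).trans hx'
  obtain ⟨B, hB, g, y, hy, hy'⟩ := exists_rep_of_family hκ ht A p r
    (hasCardinalLT_of_finite PUnit.{w + 1} κ₂ (Cardinal.IsRegular.aleph0_le Fact.out))
    (fun _ => A') (fun _ => hA') (fun _ => f) (fun _ => x ≫ p.diag.map k) (fun _ => hx'')
  refine ⟨B, hB, g, ⟨(x ≫ p.diag.map k) ≫ y, hy' ⟨⟩⟩, RepHom.ext
    ((assoc _ _ _).trans ((congrArg (fun l => (x ≫ p.diag.map k) ≫ l) hy).trans hx'')),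
    fun s => ?_⟩
  have := congrArg (fun l => l ≫ y) (hk s)
  simpa only [assoc] using this

variable (A) in
lemma isCardinalFiltered_presentableReps :
    IsCardinalFiltered (CostructuredArrow (presentableReps C κ₂ M).ι A) κ₂ := by
  rw [isCardinalFiltered_iff]
  refine ⟨fun S k hS => ?_, fun S k k' f hS => ?_⟩
  · obtain ⟨B, hB, g, y, hy⟩ := exists_presentableRep_of_family hκ ht hS
      (fun s => (k s).left.obj) (fun s => (k s).left.property) (fun s => (k s).hom)
    exact ⟨presentableOver hB g, fun s => ⟨presentableOverMap hB g _ (y s) (hy s)⟩⟩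
  -- Parallel maps are all made equal to a fixed one, `f s₀`. When there are none, only a common
  -- target of `k` and `k'` is required, and the family lemma for these two provides it.
  · by_cases hS' : Nonempty S
    · let s₀ : S := hS'.some
      obtain ⟨B, hB, g, y, hy, hy'⟩ := exists_presentableRep_of_eq hκ ht hS k'.left.obj
        k'.left.property k'.hom (fun _ => k.left.obj.X) (fun _ => k.left.property)
        (fun s => (f s).left.hom.f) (fun s => (f s₀).left.hom.f)
        (fun s => congrArg RepHom.f
          ((CostructuredArrow.w (f s)).trans (CostructuredArrow.w (f s₀)).symm))
      let u := presentableOverMap hB g k' y hy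
      refine ⟨_, u, f s₀ ≫ u, fun s => ?_⟩
      ext
      exact RepHom.ext (hy' s)
    · obtain ⟨B, hB, g, y, hy⟩ := exists_presentableRep_of_family hκ ht
        (S := ULift.{w} Bool) (A := A)
        (hasCardinalLT_of_finite _ _ (Cardinal.IsRegular.aleph0_le Fact.out))
        (fun s => (if s.down then k else k').left.obj)
        (fun s => (if s.down then k else k').left.property)
        (fun s => (if s.down then k else k').hom)
      exact ⟨presentableOver hB g,
        presentableOverMap hB g k' (y ⟨false⟩) (hy ⟨false⟩),
        presentableOverMap hB g k (y ⟨true⟩) (hy ⟨true⟩),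
        fun s => (hS' ⟨s⟩).elim⟩

end

variable (κ₂) in
/-- The forgetful functor from presentable representations over `A` to presentable objects over the
object underlying `A`. -/
def presentableRepsForget (A : RepObj C M) :
    CostructuredArrow (presentableReps C κ₂ M).ι A ⥤
      CostructuredArrow (isCardinalPresentable C κ₂).ι A.X where
  obj k := CostructuredArrow.mk (S := (isCardinalPresentable C κ₂).ι)
    (Y := (⟨k.left.obj.X, k.left.property⟩ : (isCardinalPresentable C κ₂).FullSubcategory)) k.hom.f
  map u := CostructuredArrow.homMk (ObjectProperty.homMk u.left.hom.f)
    (congrArg RepHom.f (CostructuredArrow.w u))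

/-- Lets the canonical colimit of presentable objects over `A.X` be computed over representations.
As the source is filtered, finality amounts to factoring each `Z ⟶ A.X` through a presentable
representation and equalizing two such factorizations. -/
lemma final_presentableRepsForget [HasCardinalFilteredColimits.{w} C κ₁]
    [IsCardinalAccessibleCategory C κ₂] (hκ : κ₁ < κ₂) (ht : IsUniformFor t κ₁ κ₂ M)
    (A : RepObj C M) : (presentableRepsForget κ₂ A).Final := by
  have := isCardinalFiltered_presentableReps hκ ht A
  have := isFiltered_of_isCardinalFiltered (CostructuredArrow (presentableReps C κ₂ M).ι A) κ₂
  rw [Functor.final_iff_of_isFiltered]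
  refine ⟨fun d => ?_, fun {d k} s s' => ?_⟩
  · obtain ⟨B, hB, g, y, hy⟩ := exists_presentableRep_of_hom hκ ht d.left.property d.hom
    exact ⟨presentableOver hB g,
      ⟨CostructuredArrow.homMk (ObjectProperty.homMk y) hy⟩⟩
  · obtain ⟨B, hB, g, y, hy, hy'⟩ := exists_presentableRep_of_eq hκ ht
      (hasCardinalLT_of_finite PUnit.{w + 1} κ₂ (Cardinal.IsRegular.aleph0_le Fact.out))
      k.left.obj k.left.property k.hom (fun _ => d.left.obj) (fun _ => d.left.property)
      (fun _ => s.left.hom) (fun _ => s'.left.hom)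
      (fun _ => (CostructuredArrow.w s).trans (CostructuredArrow.w s').symm)
    refine ⟨presentableOver hB g, presentableOverMap hB g k y hy, ?_⟩
    ext
    exact hy' ⟨⟩

section Small

set_option linter.unusedSectionVars false

/-- Transport of structure: the action on `X` is conjugated by `e`. It lets underlying objects be
replaced by chosen representatives. -/
lemma exists_repIso (A : RepObj C M) {X : C} (e : A.X ≅ X) :
    ∃ B : RepObj C M, B.X = X ∧ Nonempty (A ≅ B) := by
  let α : M.X ⟶ (X ⟶[V] X) :=
    (A.act.hom ≫ eHomWhiskerRight V e.inv A.X) ≫ eHomWhiskerLeft V X e.hom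
  have hα : α ≫ eHomWhiskerRight V e.hom X = A.act.hom ≫ eHomWhiskerLeft V A.X e.hom := by
    rw [assoc, assoc, eHom_whisker_exchange, ← eHomWhiskerRight_comp_assoc, e.hom_inv_id,
      eHomWhiskerRight_id, id_comp]
  let B : RepObj C M := repMk X α
    (by
      rw [← assoc, ← assoc, A.one_act, eId_whiskerRight, eHomEquiv_whiskerLeft, e.inv_hom_id,
        eHomEquiv_id])
    (by
      have h₁ := comp_eComp_whiskerRight e.inv A.act.hom A.act.hom
      have h₂ := comp_eComp_whiskerLeft (A.act.hom ≫ eHomWhiskerRight V e.inv A.X) A.act.hom e.hom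
      have h₃ := comp_eComp_middle (A.act.hom ≫ eHomWhiskerRight V e.inv A.X) e.hom α
      rw [hα] at h₃
      refine Eq.trans ?_ (h₂.trans h₃.symm)
      rw [← h₁, ← A.mul_act]
      simp only [α, assoc])
  have hB : B.act.hom = α := rfl
  let f : A ⟶ B := ⟨e.hom, hα.symm⟩
  let g : B ⟶ A := ⟨e.inv, by
    change α ≫ eHomWhiskerLeft V X e.inv = A.act.hom ≫ eHomWhiskerRight V e.inv A.X
    rw [assoc, ← eHomWhiskerLeft_comp, e.hom_inv_id, eHomWhiskerLeft_id, comp_id]⟩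
  exact ⟨B, rfl, ⟨⟨f, g, RepHom.ext e.hom_inv_id, RepHom.ext e.inv_hom_id⟩⟩⟩

variable (C κ₂ M) in
-- There is a small set of underlying objects up to isomorphism, and on each a small set of actions,
-- since these are maps in the locally small `V`.
lemma essentiallySmall_presentableReps [LocallySmall.{w} V]
    [ObjectProperty.EssentiallySmall.{w} (isCardinalPresentable C κ₂)] :
    ObjectProperty.EssentiallySmall.{w} (presentableReps C κ₂ M) := by
  obtain ⟨Q, _, -, hQ⟩ :=
    ObjectProperty.EssentiallySmall.exists_small_le.{w} (isCardinalPresentable C κ₂)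
  let R : ObjectProperty (RepObj C M) := fun A => Q A.X
  have hR : Small.{w} (Subtype R) := by
    let j (A : Subtype R) : Σ X : Subtype Q, M.X ⟶ (X.1 ⟶[V] X.1) := ⟨⟨A.1.X, A.2⟩, A.1.act.hom⟩
    refine small_of_injective (f := j) ?_
    rintro ⟨⟨X, α⟩, hX⟩ ⟨⟨Y, β⟩, hY⟩ h
    obtain ⟨h₁, h₂⟩ := Sigma.mk.inj_iff.1 h
    obtain rfl : X = Y := congrArg Subtype.val h₁
    obtain rfl : α = β := Mon.Hom.ext (eq_of_heq h₂)
    rfl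
  have : ObjectProperty.Small.{w} R := hR
  refine ⟨R, inferInstance, fun A hA => ?_⟩
  obtain ⟨X, hX, ⟨e⟩⟩ := hQ A.X hA
  obtain ⟨B, hB, ⟨i⟩⟩ := exists_repIso A e
  exact ⟨B, by change Q B.X; rwa [hB], ⟨i⟩⟩

instance [LocallySmall.{w} C] : LocallySmall.{w} (RepObj C M) where
  hom_small A B := small_of_injective (f := fun (g : A ⟶ B) => g.f) (fun _ _ h => RepHom.ext h)

end Small

section Colimits

variable [HasCardinalFilteredColimits.{w} C κ₁] (ht : IsUniformFor t κ₁ κ₂ M)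

include ht

lemma IsUniformFor.hasColimitsOfShape (J : Type w) [SmallCategory J] [IsCardinalFiltered J κ₁] :
    HasColimitsOfShape J (RepObj C M) :=
  ⟨fun A => by
    have := HasCardinalFilteredColimits.hasColimitsOfShape (κ := κ₁) C J
    obtain ⟨c, ⟨hc⟩, -⟩ := (ht.preservesFor (A ⋙ repForget C M)).exists_cocone
      (colimit.isColimit (A ⋙ repForget C M))
    exact ⟨⟨c, hc⟩⟩⟩

lemma IsUniformFor.isCardinalAccessible_repForget :
    (repForget C M).IsCardinalAccessible κ₁ where
  preservesColimitOfShape J _ _ := ⟨fun {A} => by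
    have := HasCardinalFilteredColimits.hasColimitsOfShape (κ := κ₁) C J
    obtain ⟨c, ⟨hc⟩, ⟨hc'⟩⟩ := (ht.preservesFor (A ⋙ repForget C M)).exists_cocone
      (colimit.isColimit (A ⋙ repForget C M))
    exact preservesColimit_of_preserves_colimit_cocone hc hc'⟩

/-- A map to a colimit factors through some stage on underlying objects. Equivariance of the
factorization is an equation of maps `M ⟶ [A.X, -]` valid in the colimit, hence valid at a later
stage because `M ⊗ A.X` is presentable. -/
lemma IsUniformFor.isCardinalPresentable_rep (hκ : κ₁ < κ₂) (A : RepObj C M)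
    (hA : IsCardinalPresentable A.X κ₂) : IsCardinalPresentable A κ₂ where
  preservesColimitOfShape J _ _ := ⟨fun {F} => ⟨fun {c} hc => ⟨by
    have := essentiallySmallSelf J
    have := isFiltered_of_isCardinalFiltered J κ₂
    have := IsCardinalFiltered.of_le J hκ.le
    have := ht.isCardinalAccessible_repForget
    have := (repForget C M).preservesColimitsOfShape_of_isCardinalAccessible κ₁ J
    have := ht.self.pres A.X hA
    have hc' := isColimitOfPreserves (repForget C M) hc
    refine Types.FilteredColimit.isColimitOf' _ _ (fun f => ?_) (fun j f₁ f₂ hf => ?_)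
    · change A ⟶ c.pt at f
      obtain ⟨j, g, hg⟩ := IsCardinalPresentable.exists_hom_of_isColimit κ₂ hc' f.f
      change A.X ⟶ (F.obj j).X at g
      have hg' : g ≫ (c.ι.app j).f = f.f := hg
      obtain ⟨k, u, hu⟩ := t.exists_eq κ₂ hc' (j := j)
        (A.act.hom ≫ eHomWhiskerLeft V A.X g)
        ((F.obj j).act.hom ≫ eHomWhiskerRight V g (F.obj j).X) (by
          change (A.act.hom ≫ eHomWhiskerLeft V A.X g) ≫ eHomWhiskerLeft V A.X (c.ι.app j).f =
            ((F.obj j).act.hom ≫ eHomWhiskerRight V g (F.obj j).X) ≫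
              eHomWhiskerLeft V A.X (c.ι.app j).f
          have := (c.ι.app j).comm
          have h₂ := f.comm
          rw [assoc, ← eHomWhiskerLeft_comp, hg', assoc, ← eHom_whisker_exchange, ← assoc]
          rw [h₂, ← hg', eHomWhiskerRight_comp, ← assoc]
          exact congrArg (fun k => k ≫ eHomWhiskerRight V g c.pt.X) this.symm)
      have hu' : (A.act.hom ≫ eHomWhiskerLeft V A.X g) ≫ eHomWhiskerLeft V A.X (F.map u).f =
        ((F.obj j).act.hom ≫ eHomWhiskerRight V g (F.obj j).X) ≫
          eHomWhiskerLeft V A.X (F.map u).f := hu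
      let g' : A ⟶ F.obj k := ⟨g ≫ (F.map u).f, by
        rw [eHomWhiskerLeft_comp, ← assoc, hu', assoc, ← eHom_whisker_exchange, ← assoc,
          (F.map u).comm, assoc, ← eHomWhiskerRight_comp]⟩
      refine ⟨k, g', RepHom.ext ?_⟩
      have hw : (F.map u).f ≫ (c.ι.app k).f = (c.ι.app j).f := congrArg RepHom.f (c.w u)
      change f.f = (g ≫ (F.map u).f) ≫ (c.ι.app k).f
      rw [assoc, hw, hg']
    · change A ⟶ F.obj j at f₁ f₂
      obtain ⟨k, u, hk⟩ := IsCardinalPresentable.exists_eq_of_isColimit' κ₂ hc' f₁.f f₂.f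
        (congrArg RepHom.f hf)
      exact ⟨k, u, RepHom.ext hk⟩⟩⟩⟩

lemma IsUniformFor.isCardinalFilteredGenerator [LocallySmall.{w} V]
    [IsCardinalAccessibleCategory C κ₂] (hκ : κ₁ < κ₂) :
    (presentableReps C κ₂ M).IsCardinalFilteredGenerator κ₂ where
  le_isCardinalPresentable A hA := ht.isCardinalPresentable_rep hκ A hA
  exists_colimitsOfShape A := by
    let K := CostructuredArrow (presentableReps C κ₂ M).ι A
    have := essentiallySmall_presentableReps C κ₂ M
    have : IsCardinalFiltered K κ₂ := isCardinalFiltered_presentableReps hκ ht A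
    have := final_presentableRepsForget hκ ht A
    have : EssentiallySmall.{w} K := inferInstance
    have := ht.self.acc
    have := (t.functor M.X).isCardinalAccessible_of_le hκ.le
    have := (t.functor M.X).preservesColimitsOfShape_of_isCardinalAccessible_of_essentiallySmall
      κ₂ K
    let c : Cocone (CostructuredArrow.proj (presentableReps C κ₂ M).ι A ⋙
        (presentableReps C κ₂ M).ι) :=
      { pt := A
        ι := { app k := k.hom
               naturality k k' u := (CostructuredArrow.w u).trans (comp_id _).symm } }
    -- Density of the presentable objects presents `A.X` as a colimit; finality restricts it to
    -- presentable representations over `A`, and the forgetful functor then reflects it.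
    have h := (Functor.Final.isColimitWhiskerEquiv (presentableRepsForget κ₂ A) _).symm
      ((isCardinalPresentable C κ₂).ι.denseAt A.X)
    let s : Cocone ((CostructuredArrow.proj (presentableReps C κ₂ M).ι A ⋙
        (presentableReps C κ₂ M).ι) ⋙ repForget C M) :=
      Cocone.whisker (presentableRepsForget κ₂ A) ((Functor.LeftExtension.mk (𝟭 C)
        (isCardinalPresentable C κ₂).ι.rightUnitor.inv).coconeAt A.X)
    have hs : IsColimit s := h
    have hc' : IsColimit ((repForget C M).mapCocone c) :=
      hs.ofIsoColimit (Cocone.ext (Iso.refl A.X) (fun k => (comp_id _).trans (id_comp _)))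
    have hc : IsColimit c := isColimitOfForget (t := t) hc'
    have := IsCardinalFiltered.of_equivalence κ₂ (equivSmallModel.{w} K)
    let p : (presentableReps C κ₂ M).ColimitOfShape K A :=
      { diag := _
        ι := c.ι
        isColimit := hc
        prop_diag_obj k := k.left.property }
    exact ⟨SmallModel.{w} K, inferInstance, inferInstance,
      ⟨p.reindex (equivSmallModel.{w} K).inverse⟩⟩

lemma IsUniformFor.isCardinalAccessibleCategory_rep [LocallySmall.{w} V]
    [IsCardinalAccessibleCategory C κ₂] (hκ : κ₁ < κ₂) :
    IsCardinalAccessibleCategory (RepObj C M) κ₂ := by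
  have := essentiallySmall_presentableReps C κ₂ M
  have := (ht.isCardinalFilteredGenerator hκ).hasCardinalFilteredGenerator
  exact
    { toHasCardinalFilteredGenerator := this
      hasColimitsOfShape J _ _ :=
        have := IsCardinalFiltered.of_le J hκ.le
        ht.hasColimitsOfShape J }

end Colimits

/-- Uniformization for the three functors that occur in the axioms of an action. -/
lemma exists_isUniformFor [IsAccessibleCategory.{w} C] (t : Tensoring V C)
    (ht : ∀ K : V, (t.functor K).IsAccessible.{w}) (M : Mon V) :
    ∃ (κ₁ κ₂ : Cardinal.{w}) (_ : Fact κ₁.IsRegular) (_ : Fact κ₂.IsRegular),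
      κ₁ < κ₂ ∧ IsCardinalAccessibleCategory C κ₁ ∧ IsCardinalAccessibleCategory C κ₂ ∧
        IsUniformFor t κ₁ κ₂ M := by
  obtain ⟨κ₁, κ₂, _, _, h, h₁, h₂, h₃⟩ := exists_uniform.{w}
    (fun i : Fin 3 => t.functor (![𝟙_ V, M.X, M.X ⊗ M.X] i)) (fun i => ht _)
  exact ⟨κ₁, κ₂, inferInstance, inferInstance, h, h₁, h₂,
    ⟨⟨(h₃ 0).1, (h₃ 0).2⟩, ⟨(h₃ 1).1, (h₃ 1).2⟩, ⟨(h₃ 2).1, (h₃ 2).2⟩⟩⟩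

lemma isAccessibleCategory_rep [IsAccessibleCategory.{w} C] [LocallySmall.{w} V]
    (t : Tensoring V C) (ht : ∀ K : V, (t.functor K).IsAccessible.{w}) (M : Mon V) :
    IsAccessibleCategory.{w} (RepObj C M) := by
  obtain ⟨κ₁, κ₂, _, _, h, h₁, h₂, h₃⟩ := exists_isUniformFor t ht M
  exact ⟨κ₂, inferInstance, h₃.isCardinalAccessibleCategory_rep h⟩

lemma isAccessible_repForget [IsAccessibleCategory.{w} C]
    (t : Tensoring V C) (ht : ∀ K : V, (t.functor K).IsAccessible.{w}) (M : Mon V) :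
    (repForget C M).IsAccessible.{w} := by
  obtain ⟨κ₁, κ₂, _, _, h, h₁, h₂, h₃⟩ := exists_isUniformFor t ht M
  exact ⟨κ₁, inferInstance, h₃.isCardinalAccessible_repForget⟩

/-- A functor to representations is accessible if the underlying functor is. -/
lemma isAccessible_of_comp_repForget (t : Tensoring V C)
    (ht : ∀ K : V, (t.functor K).IsAccessible.{w}) {M : Mon V} {D : Type u₁} [Category.{u₂} D]
    (G : D ⥤ RepObj C M) (hG : (G ⋙ repForget C M).IsAccessible.{w}) :
    G.IsAccessible.{w} := by
  obtain ⟨ν, hν⟩ := exists_forall_isCardinalAccessible.{w} (fun _ : Unit => t.functor M.X)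
    (fun _ => ht M.X)
  obtain ⟨κ₀, _, h₀⟩ := hG.exists_cardinal
  obtain ⟨κ, _, hκ, -⟩ := exists_isSharplyLT κ₀ (max κ₀ ν)
  have hle : κ₀ ≤ κ := (le_max_left _ _).trans hκ.le
  have := hν κ ((le_max_right _ _).trans hκ.le) ⟨⟩
  have := (G ⋙ repForget C M).isCardinalAccessible_of_le hle
  refine ⟨κ, inferInstance, ⟨fun J _ _ => ⟨fun {Z} => ⟨fun {c} hc => ⟨?_⟩⟩⟩⟩⟩
  have := (G ⋙ repForget C M).preservesColimitsOfShape_of_isCardinalAccessible κ J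
  have := (t.functor M.X).preservesColimitsOfShape_of_isCardinalAccessible κ J
  exact isColimitOfForget (t := t) (isColimitOfPreserves (G ⋙ repForget C M) hc)

end RepAccessible

section

variable {V : Type (max u (w + 1))} [Category.{w} V] [MonoidalCategory V] [MonoidalClosed V]
  {C : Type (max u (w + 1))} [Category.{w} C] [EnrichedOrdinaryCategory V C]
  [IsAccessibleCategory.{w} C]

lemma repIsAccessible (t : Tensoring V C) (ht : ∀ K : V, (t.functor K).IsAccessible.{w}) :
    RepIsAccessible.{w, u} V C where
  obj M := isAccessibleCategory_rep t ht M
  forget M := isAccessible_repForget t ht M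
  map ψ := isAccessible_of_comp_repForget t ht (repRestrict C ψ) (isAccessible_repForget t ht _)

end

/-! ### Hom objects out of filtered colimits -/

section HomLimit

variable {V : Type u'} [Category.{v'} V] [MonoidalCategory V]
  {C : Type u} [Category.{v} C] [EnrichedOrdinaryCategory V C]

/-- The diagram `j ↦ [Z j, Y]`. -/
def homDiag {J : Type u₁} [Category.{u₂} J] (Z : J ⥤ C) (Y : C) : Jᵒᵖ ⥤ V where
  obj j := Z.obj j.unop ⟶[V] Y
  map f := eHomWhiskerRight V (Z.map f.unop) Y
  map_id j := by rw [unop_id, Z.map_id, eHomWhiskerRight_id]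
  map_comp f g := by rw [unop_comp, Z.map_comp, eHomWhiskerRight_comp]

/-- The cone `[colim Z, Y] ⟶ [Z j, Y]`. -/
def homCone {J : Type u₁} [Category.{u₂} J] {Z : J ⥤ C} (c : Cocone Z) (Y : C) :
    Cone (homDiag (V := V) Z Y) where
  pt := c.pt ⟶[V] Y
  π :=
    { app j := eHomWhiskerRight V (c.ι.app j.unop) Y
      naturality j j' f := by
        refine (id_comp _).trans ((congrArg (fun k => eHomWhiskerRight V k Y) (c.w f.unop)).symm.trans
          ?_)
        exact eHomWhiskerRight_comp V _ _ _ }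

variable [MonoidalClosed V] (t : Tensoring V C) {κ : Cardinal.{w}} [Fact κ.IsRegular]
  {Q : ObjectProperty V} (hQ : Q.IsCardinalFilteredGenerator κ)
  {J : Type u₁} [Category.{u₂} J] {Z : J ⥤ C} (hZ : ∀ K, Q K → PreservesColimit Z (t.functor K))
  {c : Cocone Z} (hc : IsColimit c)

include t hQ hZ hc

/-- No single `κ` is available for the functors `E ⊗ -` with `E` arbitrary. Preservation is asked
only for `K` in a generating class `Q`, and `E` is tested on objects of `Q` of which it is the
colimit. -/
lemma eHom_hom_ext_of_generator {Y : C} {E : V} {β β' : E ⟶ (c.pt ⟶[V] Y)}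
    (h : ∀ j, β ≫ eHomWhiskerRight V (c.ι.app j) Y = β' ≫ eHomWhiskerRight V (c.ι.app j) Y) :
    β = β' := by
  obtain ⟨I, _, _, ⟨p⟩⟩ := hQ.exists_colimitsOfShape E
  refine p.isColimit.hom_ext (fun i => ?_)
  have := hZ _ (p.prop_diag_obj i)
  refine t.eHom_hom_ext (K := p.diag.obj i) hc (fun j => ?_)
  exact (assoc _ _ _).trans ((congrArg (fun k => p.ι.app i ≫ k) (h j)).trans (assoc _ _ _).symm)

lemma exists_eHom_desc_of_generator {Y : C} {E : V} (γ : ∀ j, E ⟶ (Z.obj j ⟶[V] Y))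
    (hγ : ∀ ⦃j j'⦄ (f : j ⟶ j'), γ j' ≫ eHomWhiskerRight V (Z.map f) Y = γ j) :
    ∃ β : E ⟶ (c.pt ⟶[V] Y), ∀ j, β ≫ eHomWhiskerRight V (c.ι.app j) Y = γ j := by
  obtain ⟨I, _, _, ⟨p⟩⟩ := hQ.exists_colimitsOfShape E
  have (i : I) := hZ _ (p.prop_diag_obj i)
  have hp (i : I) (j j' : J) (f : j ⟶ j') :
      (p.ι.app i ≫ γ j') ≫ eHomWhiskerRight V (Z.map f) Y = p.ι.app i ≫ γ j :=
    (assoc _ _ _).trans (congrArg (fun k => p.ι.app i ≫ k) (hγ f))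
  choose b hb using fun i => t.exists_desc (K := p.diag.obj i) hc (fun j => p.ι.app i ≫ γ j)
    (fun j j' f => hp i j j' f)
  let s : Cocone p.diag :=
    { pt := c.pt ⟶[V] Y
      ι :=
        { app := b
          naturality i i' f := by
            refine t.eHom_hom_ext (K := p.diag.obj i) hc (fun j => ?_)
            refine (assoc _ _ _).trans ((congrArg (fun k => p.diag.map f ≫ k) (hb i' j)).trans ?_)
            refine (assoc _ _ _).symm.trans ((congrArg (fun k => k ≫ γ j) (p.w f)).trans ?_)
            exact (hb i j).symm.trans
              (congrArg (fun k => k ≫ eHomWhiskerRight V (c.ι.app j) Y) (comp_id _).symm) } }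
  refine ⟨p.isColimit.desc s, fun j => p.isColimit.hom_ext (fun i => ?_)⟩
  refine (assoc _ _ _).symm.trans ?_
  exact (congrArg (fun k => k ≫ eHomWhiskerRight V (c.ι.app j) Y)
    (p.isColimit.fac s i)).trans (hb i j)

/-- In a tensored category, `[-, Y]` takes suitable colimits to limits. -/
def isLimitHomCone (Y : C) : IsLimit (homCone (V := V) c Y) :=
  have h (s : Cone (homDiag (V := V) Z Y)) := exists_eHom_desc_of_generator t hQ hZ hc (Y := Y)
    (fun j => s.π.app (op j)) (fun _ _ f => s.w f.op)
  { lift s := (h s).choose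
    fac s j := (h s).choose_spec j.unop
    uniq s _ hm := eHom_hom_ext_of_generator t hQ hZ hc
      (fun j => (hm (op j)).trans ((h s).choose_spec j).symm) }

end HomLimit

/-! ### Ends over accessible categories -/

section Wedge

variable {V : Type u'} [Category.{v'} V] {W : Type u''} [Category.{v''} W] (ι : V ⥤ W)
  [PreservesLimitsOfSize.{w, w} ι] {J : Type w} [SmallCategory J] {H : Jᵒᵖ ⥤ J ⥤ V}
  {c : Wedge H} (hc : IsLimit c)

include hc

/-- The image under `ι` of a small end is still a limit. The legs indexed by arrows factor through
those indexed by objects, so only the latter need be tested. -/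
lemma wedge_map_hom_ext {E : W} {l l' : E ⟶ ι.obj c.pt}
    (h : ∀ j, l ≫ ι.map (c.ι j) = l' ≫ ι.map (c.ι j)) : l = l' := by
  refine (isLimitOfPreserves ι hc).hom_ext ?_
  rintro (j | f)
  · exact h j
  · have hf : c.π.app (WalkingMulticospan.right f) =
        c.ι f.left ≫ (multicospanIndexEnd H).fst f := c.app_right_eq_ι_comp_fst f
    have key {a b : V} (g : c.pt ⟶ a) (k : a ⟶ b) (hg : l ≫ ι.map g = l' ≫ ι.map g) :
        l ≫ ι.map (g ≫ k) = l' ≫ ι.map (g ≫ k) := by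
      rw [ι.map_comp, ← assoc, hg, assoc]
    exact (congrArg (fun k => l ≫ ι.map k) hf).trans
      ((key _ _ (h f.left)).trans (congrArg (fun k => l' ≫ ι.map k) hf).symm)

lemma exists_wedge_map_lift {E : W} (q : ∀ j, E ⟶ ι.obj ((H.obj (op j)).obj j))
    (hq : ∀ ⦃i j : J⦄ (f : i ⟶ j), q i ≫ ι.map ((H.obj (op i)).map f) =
      q j ≫ ι.map ((H.map f.op).app j)) :
    ∃ l : E ⟶ ι.obj c.pt, ∀ j, l ≫ ι.map (c.ι j) = q j := by
  let s : Cone ((multicospanIndexEnd H).multicospan ⋙ ι) :=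
    { pt := E
      π :=
        { app a := match a with
            | .left j => q j
            | .right f => q f.left ≫ ι.map ((H.obj (op f.left)).map f.hom)
          naturality := by
            rintro _ _ (a | f | f)
            · exact (id_comp _).trans
                ((congrArg (fun k => _ ≫ k) (ι.map_id _)).trans (comp_id _)).symm
            · exact id_comp _
            · exact (id_comp _).trans (hq f.hom) } }
  exact ⟨(isLimitOfPreserves ι hc).lift s,
    fun j => (isLimitOfPreserves ι hc).fac s (WalkingMulticospan.left j)⟩

end Wedge

section End

variable {V : Type u'} [Category.{v'} V] [MonoidalCategory V]
  {C : Type u} [Category.{v} C] [EnrichedOrdinaryCategory V C]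
  {W : Type u''} [Category.{v''} W] (ι : V ⥤ W)
  {D : Type u₁} [Category.{u₂} D] (F : D ⥤ C)

/-- A family of maps `E ⟶ ι [F d, F d]` that is natural in `d`. -/
def IsWedge {E : W} (q : ∀ d, E ⟶ ι.obj (F.obj d ⟶[V] F.obj d)) : Prop :=
  ∀ ⦃d e : D⦄ (f : d ⟶ e), q d ≫ ι.map (eHomWhiskerLeft V (F.obj d) (F.map f)) =
    q e ≫ ι.map (eHomWhiskerRight V (F.map f) (F.obj e))

variable {D₀ : Type w} [SmallCategory D₀] (i : D₀ ⥤ D)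

/-- For all `d` and `Y`, `ι [F d, Y]` is the limit of `ι [F (i k), Y]`, for all `i k ⟶ d`. -/
structure IsHomDense : Prop where
  hom_ext {d : D} {Y : C} {E : W} {β β' : E ⟶ ι.obj (F.obj d ⟶[V] Y)}
    (h : ∀ (k : D₀) (x : i.obj k ⟶ d), β ≫ ι.map (eHomWhiskerRight V (F.map x) Y) =
      β' ≫ ι.map (eHomWhiskerRight V (F.map x) Y)) : β = β'
  exists_lift {d : D} {Y : C} {E : W}
    (γ : ∀ (k : D₀) (_ : i.obj k ⟶ d), E ⟶ ι.obj (F.obj (i.obj k) ⟶[V] Y))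
    (hγ : ∀ (k k' : D₀) (u : k' ⟶ k) (x : i.obj k ⟶ d),
      γ k x ≫ ι.map (eHomWhiskerRight V (F.map (i.map u)) Y) = γ k' (i.map u ≫ x)) :
    ∃ β : E ⟶ ι.obj (F.obj d ⟶[V] Y),
      ∀ k x, β ≫ ι.map (eHomWhiskerRight V (F.map x) Y) = γ k x

variable {ι F i}

lemma IsWedge.comp_left {E : W} {q : ∀ d, E ⟶ ι.obj (F.obj d ⟶[V] F.obj d)} (hq : IsWedge ι F q)
    {E' : W} (l : E' ⟶ E) : IsWedge ι F (fun d => l ≫ q d) := fun d e f => by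
  rw [assoc, hq, assoc]

/-- For `x : i k ⟶ d`, the wedge condition expresses the restriction of `q d` along `F x` as the
push-forward of `q (i k)`. In `exists_wedge` the same formula serves to define the extension. -/
lemma IsHomDense.wedge_ext (hi : IsHomDense ι F i) {E : W}
    {q q' : ∀ d, E ⟶ ι.obj (F.obj d ⟶[V] F.obj d)} (hq : IsWedge ι F q) (hq' : IsWedge ι F q')
    (h : ∀ k, q (i.obj k) = q' (i.obj k)) (d : D) : q d = q' d :=
  hi.hom_ext (fun k x => by rw [← hq, ← hq', h])

lemma IsHomDense.exists_wedge [i.Full] (hi : IsHomDense ι F i) {E : W}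
    (q : ∀ k, E ⟶ ι.obj (F.obj (i.obj k) ⟶[V] F.obj (i.obj k)))
    (hq : IsWedge ι (i ⋙ F) q) :
    ∃ q' : ∀ d, E ⟶ ι.obj (F.obj d ⟶[V] F.obj d), IsWedge ι F q' ∧ ∀ k, q' (i.obj k) = q k := by
  have hq₁ {k k' : D₀} (u : k ⟶ k') :
      q k ≫ ι.map (eHomWhiskerLeft V (F.obj (i.obj k)) (F.map (i.map u))) =
        q k' ≫ ι.map (eHomWhiskerRight V (F.map (i.map u)) (F.obj (i.obj k'))) := hq u
  choose q' hq' using fun d => hi.exists_lift (d := d) (Y := F.obj d)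
    (fun k x => q k ≫ ι.map (eHomWhiskerLeft V (F.obj (i.obj k)) (F.map x)))
    (fun k k' u x => by
      rw [assoc, ← ι.map_comp, eHom_whisker_exchange, ι.map_comp, ← assoc, ← hq₁, assoc,
        ← ι.map_comp, ← eHomWhiskerLeft_comp, ← F.map_comp])
  refine ⟨q', fun d e f => hi.hom_ext (fun k x => ?_), fun k => hi.hom_ext (fun k' x => ?_)⟩
  · rw [assoc, assoc, ← ι.map_comp, ← ι.map_comp, ← eHomWhiskerRight_comp, ← F.map_comp, hq',
      eHom_whisker_exchange, ι.map_comp, ← assoc, hq', assoc, ← ι.map_comp, ← eHomWhiskerLeft_comp,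
      ← F.map_comp]
  -- Fullness of `i` makes `x` an arrow of `D₀`, for which `q` satisfies the wedge condition.
  · obtain ⟨u, rfl⟩ := i.map_surjective x
    rw [hq', hq₁]

end End

/-! ### Reduction of a large end to a small one -/

section EndExists

variable {V : Type u'} [Category.{v'} V] [MonoidalCategory V]
  {C : Type u} [Category.{w} C] [EnrichedOrdinaryCategory V C]
  {D : Type u₁} [Category.{w} D] (F : D ⥤ C) {D₀ : Type w} [SmallCategory D₀] {i : D₀ ⥤ D}
  [i.Full]

/-- The small end over `D₀` exists in `V`. Its projections extend uniquely to a wedge on `D`, which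
is universal because wedges on `D` are determined on `D₀`. -/
lemma IsHomDense.hasEnd [HasLimitsOfSize.{w, w} V] (hi : IsHomDense (𝟭 V) F i) :
    HasEnd (homBifunctor (𝟭 V) F) := by
  have : HasEnd (homBifunctor (𝟭 V) (i ⋙ F)) := inferInstanceAs (HasLimit _)
  obtain ⟨p, hp, hp'⟩ := hi.exists_wedge (fun k => endoProj (𝟭 V) (i ⋙ F) k)
    (fun k k' f => endoProj_condition (𝟭 V) (i ⋙ F) f)
  let c : Wedge (homBifunctor (𝟭 V) F) := Wedge.mk (endoObj (𝟭 V) (i ⋙ F)) p hp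
  let l (s : Wedge (homBifunctor (𝟭 V) F)) : s.pt ⟶ endoObj (𝟭 V) (i ⋙ F) :=
    end_.lift (F := homBifunctor (𝟭 V) (i ⋙ F)) (fun k => s.ι (i.obj k))
      (fun k k' f => Wedge.condition s (i.map f))
  have hl (s : Wedge (homBifunctor (𝟭 V) F)) (k : D₀) :
      l s ≫ endoProj (𝟭 V) (i ⋙ F) k = s.ι (i.obj k) :=
    end_.lift_π (F := homBifunctor (𝟭 V) (i ⋙ F)) _ _ k
  have hc : IsLimit c := Multifork.IsLimit.mk _ l
    (fun s d => hi.wedge_ext (hp.comp_left (l s)) (fun _ _ f => Wedge.condition s f)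
      (fun k => (congrArg (fun q => l s ≫ q) (hp' k)).trans (hl s k)) d)
    (fun s m hm => end_.hom_ext (F := homBifunctor (𝟭 V) (i ⋙ F)) (fun k =>
      (congrArg (fun q => m ≫ q) (hp' k)).symm.trans ((hm (i.obj k)).trans (hl s k).symm)))
  exact ⟨⟨c, hc⟩⟩

variable {W : Type u''} [Category.{v''} W] (ι : V ⥤ W) [PreservesLimitsOfSize.{w, w} ι]
  [HasEnd (homBifunctor (𝟭 V) F)] (hi : IsHomDense (𝟭 V) F i) (hi' : IsHomDense ι F i)

variable (V i) in
/-- The restriction to `i : D₀ ⥤ D` of the universal wedge for `F`. -/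
def restrictWedge : Wedge (homBifunctor (𝟭 V) (i ⋙ F)) :=
  Wedge.mk (endoObj (𝟭 V) F) (fun k => endoProj (𝟭 V) F (i.obj k))
    (fun _ _ f => endoProj_condition (𝟭 V) F (i.map f))

variable {F}

/-- The end of `[F -, F -]` can be computed over `D₀`. -/
def IsHomDense.isLimitRestrictWedge : IsLimit (restrictWedge V F i) :=
  have h (s : Wedge (homBifunctor (𝟭 V) (i ⋙ F))) :=
    hi.exists_wedge (fun k => s.ι k) (fun _ _ f => Wedge.condition s f)
  have hl (s : Wedge (homBifunctor (𝟭 V) (i ⋙ F))) (d : D) :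
      end_.lift (F := homBifunctor (𝟭 V) F) (h s).choose (h s).choose_spec.1 ≫
        endoProj (𝟭 V) F d = (h s).choose d :=
    end_.lift_π (F := homBifunctor (𝟭 V) F) _ _ d
  Multifork.IsLimit.mk _
    (fun s => end_.lift (F := homBifunctor (𝟭 V) F) (h s).choose (h s).choose_spec.1)
    (fun s k => (hl s (i.obj k)).trans ((h s).choose_spec.2 k))
    (fun s m hm => end_.hom_ext (F := homBifunctor (𝟭 V) F) (fun d =>
      hi.wedge_ext
        (IsWedge.comp_left (fun _ _ f => endoProj_condition (𝟭 V) F f) m)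
        (IsWedge.comp_left (fun _ _ f => endoProj_condition (𝟭 V) F f) _)
        (fun k => (hm k).trans ((hl s (i.obj k)).trans ((h s).choose_spec.2 k)).symm) d))

include hi

lemma IsHomDense.map_endo_hom_ext {E : W} {l l' : E ⟶ ι.obj (endoObj (𝟭 V) F)}
    (h : ∀ d, l ≫ ι.map (endoProj (𝟭 V) F d) = l' ≫ ι.map (endoProj (𝟭 V) F d)) : l = l' :=
  wedge_map_hom_ext ι hi.isLimitRestrictWedge (fun k => h (i.obj k))

include hi'

/-- The lift comes from the small end over `D₀`, which `ι` preserves. Agreement at all other `d`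
uses density after applying `ι`, that is, `hi'`. -/
lemma IsHomDense.exists_map_endo_lift {E : W} (q : ∀ d, E ⟶ ι.obj (F.obj d ⟶[V] F.obj d))
    (hq : IsWedge ι F q) :
    ∃ l : E ⟶ ι.obj (endoObj (𝟭 V) F), ∀ d, l ≫ ι.map (endoProj (𝟭 V) F d) = q d := by
  obtain ⟨l, hl⟩ := exists_wedge_map_lift ι hi.isLimitRestrictWedge (fun k => q (i.obj k))
    (fun _ _ f => hq (i.map f))
  have hp : IsWedge ι F (fun d => ι.map (endoProj (𝟭 V) F d)) := fun d e f =>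
    (ι.map_comp _ _).symm.trans
      ((congrArg ι.map (endoProj_condition (𝟭 V) F f)).trans (ι.map_comp _ _))
  exact ⟨l, hi'.wedge_ext (hp.comp_left l) hq hl⟩

end EndExists

/-! ### Density of the presentable objects for enriched homs -/

section Dense

/-- The canonical cocone of a functor `i : D₀ ⥤ D` at `d : D`. -/
def canonicalCocone {D₀ : Type u} [Category.{v} D₀] {D : Type u'} [Category.{v'} D] (i : D₀ ⥤ D)
    (d : D) : Cocone (CostructuredArrow.proj i d ⋙ i) where
  pt := d
  ι :=
    { app k := k.hom
      naturality _ _ u := (CostructuredArrow.w u).trans (comp_id _).symm }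

/-- If `i` is dense, then the canonical cocone is a colimit. -/
def isColimitCanonicalCocone {D₀ : Type u} [Category.{v} D₀] {D : Type u'} [Category.{v'} D]
    (i : D₀ ⥤ D) [i.IsDense] (d : D) : IsColimit (canonicalCocone i d) :=
  (i.denseAt d).ofIsoColimit (Cocone.ext (Iso.refl d) (fun _ => (comp_id _).trans (id_comp _)))

variable (D : Type u) [Category.{v} D] (κ : Cardinal.{w}) [Fact κ.IsRegular]
  [IsCardinalAccessibleCategory D κ]

/-- A small category equivalent to the category of `κ`-presentable objects. -/
abbrev SmallPresentables : Type w := SmallModel.{w} (isCardinalPresentable D κ).FullSubcategory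

/-- The inclusion of the small category of `κ`-presentable objects. -/
abbrev smallPresentablesι : SmallPresentables D κ ⥤ D :=
  (equivSmallModel (isCardinalPresentable D κ).FullSubcategory).inverse ⋙
    (isCardinalPresentable D κ).ι

instance (d : D) : IsCardinalFiltered (CostructuredArrow (smallPresentablesι D κ) d) κ :=
  IsCardinalFiltered.of_equivalence κ
    (CostructuredArrow.pre (equivSmallModel (isCardinalPresentable D κ).FullSubcategory).inverse
      (isCardinalPresentable D κ).ι d).asEquivalence.symm

variable {D κ} {V : Type u'} [Category.{v'} V] [MonoidalCategory V] [MonoidalClosed V]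
  {C : Type u₁} [Category.{u₂} C] [EnrichedOrdinaryCategory V C] (t : Tensoring V C)
  {κ' : Cardinal.{w}} [Fact κ'.IsRegular]
  {Q : ObjectProperty V} (hQ : Q.IsCardinalFilteredGenerator κ')
  (hκ : ∀ K, Q K → (t.functor K).IsCardinalAccessible κ)
  (F : D ⥤ C) [F.IsCardinalAccessible κ]
  {W : Type u''} [Category.{v''} W] (ι : V ⥤ W) [PreservesLimitsOfSize.{w, w} ι]

include hQ hκ

/-- Each `d` is the `κ`-filtered colimit of the presentable objects over it. `F` preserves this
colimit, `[-, Y]` turns it into a limit, and `ι` preserves that limit since its shape is essentially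
small. -/
lemma isHomDense_smallPresentablesι : IsHomDense ι F (smallPresentablesι D κ) := by
  have key (d : D) (Y : C) : Nonempty (IsLimit (ι.mapCone
      (homCone (V := V) (F.mapCocone (canonicalCocone (smallPresentablesι D κ) d)) Y))) := by
    let K := CostructuredArrow (smallPresentablesι D κ) d
    have : EssentiallySmall.{w} K := inferInstance
    have := F.preservesColimitsOfShape_of_isCardinalAccessible_of_essentiallySmall κ K
    have : PreservesLimitsOfShape (SmallModel.{w} K)ᵒᵖ ι := inferInstance
    have : PreservesLimitsOfShape Kᵒᵖ ι :=
      preservesLimitsOfShape_of_equiv (equivSmallModel.{w} K).op.symm ι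
    exact ⟨isLimitOfPreserves ι (isLimitHomCone t hQ
      (fun L hL => by
        have := hκ L hL
        have := (t.functor L).preservesColimitsOfShape_of_isCardinalAccessible_of_essentiallySmall κ K
        infer_instance)
      (isColimitOfPreserves F (isColimitCanonicalCocone (smallPresentablesι D κ) d)) Y)⟩
  exact
    { hom_ext {d Y E β β'} h := (key d Y).some.hom_ext (fun k => h k.unop.left k.unop.hom)
      exists_lift {d Y E} γ hγ := by
        let s : Cone (homDiag (V := V) ((CostructuredArrow.proj (smallPresentablesι D κ) d ⋙
            smallPresentablesι D κ) ⋙ F) Y ⋙ ι) :=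
          { pt := E
            π :=
              { app k := γ k.unop.left k.unop.hom
                naturality k k' u := by
                  refine (id_comp _).trans (Eq.trans ?_
                    (hγ k.unop.left k'.unop.left u.unop.left k.unop.hom).symm)
                  rw [CostructuredArrow.w] } }
        exact ⟨(key d Y).some.lift s, fun k x =>
          (key d Y).some.fac s (op (CostructuredArrow.mk x))⟩ }

end Dense

section ExistsDense

variable {V : Type u'} [Category.{v'} V] [MonoidalCategory V] [MonoidalClosed V]
  [IsAccessibleCategory.{w} V]
  {C : Type u} [Category.{v} C] [EnrichedOrdinaryCategory V C] (t : Tensoring V C)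
  (ht : ∀ K : V, (t.functor K).IsAccessible.{w})
  {D : Type u₁} [Category.{w} D] [IsAccessibleCategory.{w} D] (F : D ⥤ C) (hF : F.IsAccessible.{w})
  {W : Type u''} [Category.{v''} W] (ι : V ⥤ W) [PreservesLimitsOfSize.{w, w} ι]

include ht hF

/-- Accessibility of `V` supplies a small generator, so one `κ` can exceed the indices of `F` and of
all `K ⊗ -` with `K` in it, while `D` is `κ`-accessible. The same `D₀` serves for `𝟭 V` and for `ι`.
-/
lemma exists_isHomDense : ∃ (D₀ : Type w) (_ : SmallCategory D₀) (i : D₀ ⥤ D) (_ : i.Full),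
    IsHomDense (𝟭 V) F i ∧ IsHomDense ι F i := by
  obtain ⟨κ', _, _⟩ := IsAccessibleCategory.exists_cardinal.{w} V
  obtain ⟨Q, _, hQ⟩ := HasCardinalFilteredGenerator.exists_small_generator.{w} V κ'
  obtain ⟨ν₁, h₁⟩ := exists_forall_isCardinalAccessible.{w}
    (fun K : Subtype Q => t.functor K.1) (fun K => ht K.1)
  obtain ⟨ν₂, h₂⟩ := exists_forall_isCardinalAccessible.{w} (fun _ : Unit => F) (fun _ => hF)
  obtain ⟨κ, _, hκ, _⟩ := exists_isCardinalAccessibleCategory D (max ν₁ ν₂)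
  have := h₂ κ ((le_max_right _ _).trans hκ.le) ⟨⟩
  have hQ' (K : V) (hK : Q K) := h₁ κ ((le_max_left _ _).trans hκ.le) ⟨K, hK⟩
  exact ⟨SmallPresentables D κ, inferInstance, smallPresentablesι D κ, inferInstance,
    isHomDense_smallPresentablesι t hQ hQ' F (𝟭 V),
    isHomDense_smallPresentablesι t hQ hQ' F ι⟩

end ExistsDense

/-! ### The endomorphism monoid in `V` and its universal property -/

section EndoId

variable {V : Type u'} [Category.{v'} V] [MonoidalCategory V]
  {C : Type u} [Category.{v} C] [EnrichedOrdinaryCategory V C]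
  {D : Type u₁} [Category.{v} D] (F : D ⥤ C) [HasEnd (homBifunctor (𝟭 V) F)]

variable (V) in
/-- The endomorphism monoid of `F`, computed in `V`. -/
abbrev endoId : Mon V := endo (𝟭 V) F

/-- The projection of the endomorphism monoid of `F` on `[F d, F d]`. -/
def endoIdπ (d : D) : endoId V F ⟶ endMon V (F.obj d) :=
  Mon.Hom.mk' (N := endMon V (F.obj d)) (endoProj (𝟭 V) F d)
    ((endoOne_proj (𝟭 V) F d).trans (id_comp _))
    ((endoMul_proj (𝟭 V) F d).trans (congrArg (fun k => _ ≫ k) (id_comp _)))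

lemma endoIdπ_condition {d e : D} (f : d ⟶ e) :
    (endoIdπ F d).hom ≫ eHomWhiskerLeft V (F.obj d) (F.map f) =
      (endoIdπ F e).hom ≫ eHomWhiskerRight V (F.map f) (F.obj e) :=
  endoProj_condition (𝟭 V) F f

variable {F} in
lemma endoId_hom_ext {M : Mon V} {f g : M ⟶ endoId V F}
    (h : ∀ d, f ≫ endoIdπ F d = g ≫ endoIdπ F d) : f = g :=
  Mon.Hom.ext (end_.hom_ext (F := homBifunctor (𝟭 V) F) (fun d => congrArg Mon.Hom.hom (h d)))

/-- A monoid, as the image of itself under the identity functor. -/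
def toIdMon (A : Mon V) : A ⟶ (𝟭 V).mapMon.obj A :=
  Mon.Hom.mk' (N := (𝟭 V).mapMon.obj A) (𝟙 A.X) ((comp_id _).trans (id_comp _).symm)
    ((comp_id _).trans ((id_comp _).symm.trans
      (congrArg₂ (fun k l => k ≫ l) (id_tensorHom_id _ _).symm (id_comp _).symm)))

/-- Maps of monoids to the endomorphism monoid of `F` are compatible families of maps of monoids
to the `[F d, F d]`. -/
def endoIdLift {M : Mon V} (f : ∀ d, M ⟶ endMon V (F.obj d))
    (hf : ∀ ⦃i j : D⦄ (g : i ⟶ j), (f i).hom ≫ eHomWhiskerLeft V (F.obj i) (F.map g) =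
      (f j).hom ≫ eHomWhiskerRight V (F.map g) (F.obj j)) : M ⟶ endoId V F :=
  endoLift (𝟭 V) F (fun d => f d ≫ toIdMon _) (fun i j g =>
    (congrArg (fun k => k ≫ eHomWhiskerLeft V (F.obj i) (F.map g)) (comp_id (f i).hom)).trans
      ((hf g).trans (congrArg (fun k => k ≫ eHomWhiskerRight V (F.map g) (F.obj j))
        (comp_id (f j).hom)).symm))

lemma endoIdLift_π {M : Mon V} (f : ∀ d, M ⟶ endMon V (F.obj d))
    (hf : ∀ ⦃i j : D⦄ (g : i ⟶ j), (f i).hom ≫ eHomWhiskerLeft V (F.obj i) (F.map g) =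
      (f j).hom ≫ eHomWhiskerRight V (F.map g) (F.obj j)) (d : D) :
    endoIdLift F f hf ≫ endoIdπ F d = f d :=
  Mon.Hom.ext ((congrArg Mon.Hom.hom (endoLift_π (𝟭 V) F (fun d => f d ≫ toIdMon _) _ d)).trans
    (comp_id (f d).hom))

lemma endoIdMap_π {D' : Type u₂} [Category.{v} D'] (Φ : D' ⥤ D)
    [HasEnd (homBifunctor (𝟭 V) (Φ ⋙ F))] (d : D') :
    endoMap (𝟭 V) F Φ rfl ≫ endoIdπ (Φ ⋙ F) d = endoIdπ F (Φ.obj d) := by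
  have h := congrArg Mon.Hom.hom
    ((endoMap_π (𝟭 V) F Φ rfl d).trans (comp_id (endoπ (𝟭 V) F (Φ.obj d))))
  exact Mon.Hom.ext h

variable {F} {M : Mon V}

/-- The functor to representations of `M` corresponding to a map from `M` to the endomorphism monoid
of `F`. -/
def endoRep (φ : M ⟶ endoId V F) : D ⥤ RepObj C M where
  obj d := ⟨F.obj d, φ ≫ endoIdπ F d⟩
  map f := ⟨F.map f, (assoc _ _ _).trans
    ((congrArg (fun k => φ.hom ≫ k) (endoIdπ_condition F f)).trans (assoc _ _ _).symm)⟩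
  map_id d := RepHom.ext (F.map_id d)
  map_comp f g := RepHom.ext (F.map_comp f g)

lemma endoRep_comp (φ : M ⟶ endoId V F) : endoRep φ ⋙ repForget C M = F := rfl

lemma endoRep_restrict {M' : Mon V} (ψ : M' ⟶ M) (φ : M ⟶ endoId V F) :
    endoRep (ψ ≫ φ) = endoRep φ ⋙ repRestrict C ψ := by
  have h (d : D) : (endoRep (ψ ≫ φ)).obj d = (endoRep φ ⋙ repRestrict C ψ).obj d :=
    congrArg (RepObj.mk (F.obj d)) (assoc ψ φ (endoIdπ F d))
  exact CategoryTheory.Functor.hext h (fun d e f => repHom_heq (h d) (h e)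
    ((endoRep (ψ ≫ φ)).map f) ((endoRep φ ⋙ repRestrict C ψ).map f) HEq.rfl)

/-- The map from `M` to the endomorphism monoid of `F` corresponding to a functor to representations
of `M`. -/
def repEndo (G : D ⥤ RepObj C M) (h : G ⋙ repForget C M = F) : M ⟶ endoId V F :=
  endoIdLift F
    (fun d => (G.obj d).act ≫ eqToHom (congrArg (endMon V) (Functor.congr_obj h d)))
    (by
      subst h
      intro i j g
      have h (d : D) : (G.obj d).act ≫ 𝟙 (endMon V (G.obj d).X) = (G.obj d).act := comp_id _
      exact (congrArg (fun k => k.hom ≫ eHomWhiskerLeft V (G.obj i).X (G.map g).f) (h i)).trans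
        ((G.map g).comm.trans
          (congrArg (fun k => k.hom ≫ eHomWhiskerRight V (G.map g).f (G.obj j).X) (h j)).symm))

lemma repEndo_π (G : D ⥤ RepObj C M) (h : G ⋙ repForget C M = F) (d : D) :
    repEndo G h ≫ endoIdπ F d =
      (G.obj d).act ≫ eqToHom (congrArg (endMon V) (Functor.congr_obj h d)) :=
  endoIdLift_π F _ _ d

lemma repEndo_endoRep (φ : M ⟶ endoId V F) : repEndo (endoRep φ) (endoRep_comp φ) = φ :=
  endoId_hom_ext (fun d => (repEndo_π (endoRep φ) _ d).trans (comp_id (φ ≫ endoIdπ F d)))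

lemma endoRep_repEndo (G : D ⥤ RepObj C M) (h : G ⋙ repForget C M = F) :
    endoRep (repEndo G h) = G := by
  subst h
  have h (d : D) : (endoRep (repEndo G rfl)).obj d = G.obj d :=
    congrArg (RepObj.mk (G.obj d).X) ((repEndo_π G rfl d).trans (comp_id (G.obj d).act))
  exact CategoryTheory.Functor.hext h (fun d e f => repHom_heq (h d) (h e)
    ((endoRep (repEndo G rfl)).map f) (G.map f) HEq.rfl)

/-- Naturality in `F` of the bijection behind the adjunction; `endoRep_restrict` is its naturality
in `M`. -/
lemma repEndo_map (G : D ⥤ RepObj C M) (h : G ⋙ repForget C M = F) {D' : Type u₂}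
    [Category.{v} D'] (Φ : D' ⥤ D) {F' : D' ⥤ C} (hΦ : Φ ⋙ F = F')
    [HasEnd (homBifunctor (𝟭 V) F')] (h' : (Φ ⋙ G) ⋙ repForget C M = F') :
    repEndo (Φ ⋙ G) h' = repEndo G h ≫ endoMap (𝟭 V) F Φ hΦ := by
  subst h hΦ
  refine endoId_hom_ext (fun d =>
    ((repEndo_π (Φ ⋙ G) h' d).trans (comp_id (G.obj (Φ.obj d)).act)).trans ?_)
  rw [assoc]
  exact ((congrArg (fun k => repEndo G rfl ≫ k) (endoIdMap_π (G ⋙ repForget C M) Φ d)).trans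
    ((repEndo_π G rfl (Φ.obj d)).trans (comp_id (G.obj (Φ.obj d)).act))).symm

end EndoId

/-! ### Comparison of the endomorphism monoids in `V` and in an enlargement of `V` -/

section Compare

variable {V : Type u'} [Category.{v'} V] [MonoidalCategory V]
  {C : Type u} [Category.{v} C] [EnrichedOrdinaryCategory V C]
  {W : Type u''} [Category.{v''} W] [MonoidalCategory W] (ι : V ⥤ W) [ι.LaxMonoidal]
  {D : Type u₁} [Category.{v} D] (F : D ⥤ C) [HasEnd (homBifunctor (𝟭 V) F)]
  [HasEnd (homBifunctor ι F)]

/-- The canonical map from the image of the endomorphism monoid of `F` in `V` to the endomorphism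
monoid of `F` in `W`. -/
def endoCompare : ι.mapMon.obj (endoId V F) ⟶ endo ι F :=
  endoLift ι F (fun d => ι.mapMon.map (endoIdπ F d)) (fun _ _ f =>
    (ι.map_comp _ _).symm.trans
      ((congrArg ι.map (endoIdπ_condition F f)).trans (ι.map_comp _ _)))

lemma endoCompare_π (d : D) : endoCompare ι F ≫ endoπ ι F d = ι.mapMon.map (endoIdπ F d) :=
  endoLift_π ι F _ _ d

lemma endoCompare_naturality {D' : Type u₂} [Category.{v} D'] (Φ : D' ⥤ D) {F' : D' ⥤ C}
    (h : Φ ⋙ F = F') [HasEnd (homBifunctor (𝟭 V) F')] [HasEnd (homBifunctor ι F')] :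
    ι.mapMon.map (endoMap (𝟭 V) F Φ h) ≫ endoCompare ι F' =
      endoCompare ι F ≫ endoMap ι F Φ h := by
  subst h
  refine endo_hom_ext (fun d => ?_)
  have h₁ : endoMap ι F Φ rfl ≫ endoπ ι (Φ ⋙ F) d = endoπ ι F (Φ.obj d) :=
    (endoMap_π ι F Φ rfl d).trans (comp_id _)
  rw [assoc, assoc, endoCompare_π, ← Functor.map_comp, endoIdMap_π]
  exact (endoCompare_π ι F (Φ.obj d)).symm.trans
    (congrArg (fun k => endoCompare ι F ≫ k) h₁.symm)

end Compare

section CompareIso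

variable {V : Type u'} [Category.{v'} V] [MonoidalCategory V]
  {C : Type u} [Category.{w} C] [EnrichedOrdinaryCategory V C]
  {W : Type u''} [Category.{v''} W] [MonoidalCategory W] (ι : V ⥤ W) [ι.LaxMonoidal]
  [PreservesLimitsOfSize.{w, w} ι]
  {D : Type u₁} [Category.{w} D] (F : D ⥤ C) [HasEnd (homBifunctor (𝟭 V) F)]
  [HasEnd (homBifunctor ι F)] {D₀ : Type w} [SmallCategory D₀] {i : D₀ ⥤ D} [i.Full]

/-- The image under `ι` of the end in `V` has the universal property of the end in `W`. An inverse
is needed only on underlying objects, since the forgetful functor from monoids reflects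
isomorphisms. -/
lemma IsHomDense.isIso_endoCompare (hi : IsHomDense (𝟭 V) F i) (hi' : IsHomDense ι F i) :
    IsIso (endoCompare ι F) := by
  obtain ⟨l, hl⟩ := hi.exists_map_endo_lift ι hi' (fun d => endoProj ι F d)
    (fun _ _ f => endoProj_condition ι F f)
  have hc (d : D) : (endoCompare ι F).hom ≫ endoProj ι F d = ι.map (endoProj (𝟭 V) F d) :=
    congrArg Mon.Hom.hom (endoCompare_π ι F d)
  have : IsIso ((Mon.forget W).map (endoCompare ι F)) := by
    refine ⟨l, ?_, ?_⟩
    · refine hi.map_endo_hom_ext ι (fun d => ?_)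
      refine (assoc _ _ _).trans ((congrArg (fun k => (endoCompare ι F).hom ≫ k) (hl d)).trans ?_)
      exact (hc d).trans (id_comp _).symm
    · refine end_.hom_ext (F := homBifunctor ι F) (fun d => ?_)
      refine (assoc _ _ _).trans ((congrArg (fun k => l ≫ k) (hc d)).trans ?_)
      exact (hl d).trans (id_comp _).symm
  exact isIso_of_reflects_iso (endoCompare ι F) (Mon.forget W)

end CompareIso

/-! ### The adjunction between representations and endomorphism monoids -/

section Adjunction

variable {V : Type (max u (w + 1))} [Category.{w} V] [MonoidalCategory V]
  {C : Type (max u (w + 1))} [Category.{w} C] [EnrichedOrdinaryCategory V C]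
  [IsAccessibleCategory.{w} C]

/-- The functor `D ⥤ C` underlying an object of `Acc / C`. -/
abbrev accFunctor (X : Over (AccCat.mk.{w, max u (w + 1)} C)) : X.left.carrier ⥤ C :=
  X.hom.1

lemma accFunctor_w {X Y : Over (AccCat.mk.{w, max u (w + 1)} C)} (Φ : X ⟶ Y) :
    Φ.left.1 ⋙ accFunctor Y = accFunctor X :=
  congrArg Subtype.val (Over.w Φ)

variable (V C) in
/-- All the ends of `[F -, F -]` exist, for `F : D ⥤ C` in `Acc / C`. -/
class HasAccEnds : Prop where
  hasEnd (X : Over (AccCat.mk.{w, max u (w + 1)} C)) :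
    HasEnd (homBifunctor (𝟭 V) (accFunctor X))

attribute [instance] HasAccEnds.hasEnd

variable [HasAccEnds.{w, u} V C]

variable (V C) in
/-- The functor `(Acc / C)ᵒᵖ ⥤ Mon V` sending `F` to its endomorphism monoid. -/
def accEndo : (Over (AccCat.mk.{w, max u (w + 1)} C))ᵒᵖ ⥤ Mon V where
  obj X := endoId V (accFunctor X.unop)
  map {X _} Φ := endoMap (𝟭 V) (accFunctor X.unop) Φ.unop.left.1 (accFunctor_w Φ.unop)
  map_id X := endoMap_id (𝟭 V) (accFunctor X.unop) _
  map_comp {X _ _} Φ Ψ := endoMap_comp (𝟭 V) (accFunctor X.unop) Φ.unop.left.1 _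
    Ψ.unop.left.1 _ _

variable (h : RepIsAccessible.{w, u} V C)
  (hG : ∀ (M : Mon V) (X : Over (AccCat.mk.{w, max u (w + 1)} C))
    (G : X.left.carrier ⥤ RepObj C M), G ⋙ repForget C M = accFunctor X → G.IsAccessible.{w})

include hG in
/-- The bijection between maps of `Acc / C` to `Rep M` and maps of monoids from `M` to the
endomorphism monoid. -/
def repHomEquiv (M : Mon V) (X : (Over (AccCat.mk.{w, max u (w + 1)} C))ᵒᵖ) :
    (h.functor.obj M ⟶ X) ≃ (M ⟶ (accEndo V C).obj X) where
  toFun Φ := repEndo (F := accFunctor X.unop) Φ.unop.left.1 (accFunctor_w Φ.unop)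
  invFun φ :=
    letI := h.obj M
    Quiver.Hom.op (Over.homMk (U := X.unop) (V := h.over M)
      -- Every functor over `C` from an accessible category to `Rep M` is assumed accessible in
      -- `hG`, so passing from `Cat / C` to `Acc / C` loses none of these maps.
      ⟨endoRep φ, hG M X.unop (endoRep φ) (endoRep_comp φ)⟩
      (Subtype.ext (endoRep_comp φ)))
  left_inv Φ := Quiver.Hom.unop_inj (Over.OverMorphism.ext (Subtype.ext
    (endoRep_repEndo (F := accFunctor X.unop) Φ.unop.left.1 (accFunctor_w Φ.unop))))
  right_inv φ := repEndo_endoRep φ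

/-- The functor `Rep` is left adjoint to the functor sending `F` to its endomorphism monoid. -/
def repAdjunction : h.functor ⊣ accEndo V C :=
  Adjunction.mkOfHomEquiv
    { homEquiv := repHomEquiv h hG
      homEquiv_naturality_left_symm ψ φ :=
        Quiver.Hom.unop_inj (Over.OverMorphism.ext (Subtype.ext (endoRep_restrict ψ φ)))
      homEquiv_naturality_right {_ Y _} Φ Ψ :=
        repEndo_map (F := accFunctor Y.unop) Φ.unop.left.1 (accFunctor_w Φ.unop)
          Ψ.unop.left.1 (accFunctor_w Ψ.unop) (accFunctor_w (Φ ≫ Ψ).unop) }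

/-- The unit corresponds to the identity functor of `Rep M`, whose component at `A` is the action of
`A` itself. -/
lemma repAdjunction_unit_π (M : Mon V) (A : RepObj C M) :
    (repAdjunction h hG).unit.app M ≫ endoIdπ (accFunctor (h.over M)) A = A.act :=
  (repEndo_π (F := accFunctor (h.over M)) (𝟭 (RepObj C M)) rfl A).trans (comp_id A.act)

variable {W : Type u'} [Category.{max u (w + 1)} W] [MonoidalCategory W]
  [HasLimitsOfSize.{max u (w + 1), max u (w + 1)} W] (ι : V ⥤ W) [ι.LaxMonoidal]

/-- The comparison of the endomorphism monoids in `V` and in `W`, for functors of `Acc / C`. -/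
def accEndoCompare :
    accEndo V C ⋙ ι.mapMon ⟶ (accOverForget C).op ⋙ endoFunctor C ι where
  app X := endoCompare ι (accFunctor X.unop)
  naturality X _ Φ := endoCompare_naturality ι (accFunctor X.unop) Φ.unop.left.1
    (accFunctor_w Φ.unop)

end Adjunction

end EndRep

end

/-! ### The main theorem -/

theorem mainTheorem4
    (V : Type (max u (w + 1))) [Category.{w} V] [MonoidalCategory V] [MonoidalClosed V]
    [HasLimits V] [HasColimits V] [IsAccessibleCategory.{w} V]
    (C : Type (max u (w + 1))) [Category.{w} C] [EnrichedOrdinaryCategory V C]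
    [IsAccessibleCategory.{w} C] (hC : EndRep.IsAccessiblyTensored.{w} V C) :
    ∃ (h : EndRep.RepIsAccessible.{w, u} V C)
      (E : (Over (EndRep.AccCat.mk.{w, max u (w + 1)} C))ᵒᵖ ⥤ Mon V)
      (adj : h.functor ⊣ E),
      ∀ (W : Type u') [Category.{max u (w + 1)} W] [MonoidalCategory W]
        [HasLimitsOfSize.{max u (w + 1), max u (w + 1)} W]
        (ι : V ⥤ W) [ι.Monoidal] [ι.Full] [ι.Faithful] [PreservesLimitsOfSize.{w, w} ι],
        ∃ e : E ⋙ ι.mapMon ≅ (EndRep.accOverForget C).op ⋙ EndRep.endoFunctor C ι,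
          ∀ (M : Mon V) (A : EndRep.RepObj C M),
            ι.mapMon.map (adj.unit.app M) ≫ e.hom.app (op (h.over M)) ≫
              EndRep.endoπ ι (EndRep.repForget C M) A = ι.mapMon.map A.act := by

  obtain ⟨t, ht⟩ := hC
  have hEnd : EndRep.HasAccEnds.{w, u} V C := ⟨fun X => by
    obtain ⟨D₀, _, i, _, hi, -⟩ :=
      EndRep.exists_isHomDense t ht (EndRep.accFunctor X) X.hom.2 (𝟭 V)
    exact hi.hasEnd⟩
  let h := EndRep.repIsAccessible.{w, u} t ht
  -- The forgetful functor reflects the relevant colimits, so a functor to `Rep M` is accessible as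
  -- soon as its composite to `C`, here the structure map of `X`, is.
  have hG (M : Mon V) (X : Over (EndRep.AccCat.mk.{w, max u (w + 1)} C))
      (G : X.left.carrier ⥤ EndRep.RepObj C M)
      (hG : G ⋙ EndRep.repForget C M = EndRep.accFunctor X) : G.IsAccessible.{w} :=
    EndRep.isAccessible_of_comp_repForget t ht G (by rw [hG]; exact X.hom.2)
  refine ⟨h, EndRep.accEndo V C, EndRep.repAdjunction h hG, ?_⟩
  intro W _ _ _ ι _ _ _ _
  have hι (X : (Over (EndRep.AccCat.mk.{w, max u (w + 1)} C))ᵒᵖ) :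
      IsIso ((EndRep.accEndoCompare ι).app X) := by
    obtain ⟨D₀, _, i, _, hi, hi'⟩ :=
      EndRep.exists_isHomDense t ht (EndRep.accFunctor X.unop) X.unop.hom.2 ι
    exact hi.isIso_endoCompare ι (EndRep.accFunctor X.unop) hi'
  have : IsIso (EndRep.accEndoCompare (C := C) ι) := NatIso.isIso_of_isIso_app _
  refine ⟨asIso (EndRep.accEndoCompare ι), fun M A => ?_⟩
  -- The comparison followed by a projection is the image under `ι` of the projection in `V`, which
  -- reduces the claim to the description of the unit in `V`.
  refine (congrArg (fun k => ι.mapMon.map ((EndRep.repAdjunction h hG).unit.app M) ≫ k)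
    (EndRep.endoCompare_π ι (EndRep.accFunctor (h.over M)) A)).trans ?_
  exact (ι.mapMon.map_comp _ _).symm.trans
    (congrArg ι.mapMon.map (EndRep.repAdjunction_unit_π h hG M A))
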